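/- Let $n\ge 1$ and $\sigma\in\{+,-\}^{n-1}$. Put $\widetilde\sigma=(+,-,\sigma,-,+)$, a sequence of $n+3$ signs indexed by the labels $0,1,\dots,n+2$, and place vertices labelled $0,1,\dots,n+2$ from left to right in convex position in the plane, vertex $k$ above a fixed horizontal line if $\widetilde\sigma(k)=+$ and below it if $\widetilde\sigma(k)=-$. (Concretely, take the vertex $k$ at $(k,\widetilde\sigma(k)\,(k+1)(n+3-k))$; only the combinatorics of the placement matters.) For a diagonal $\delta=ij$, $i<j$, of the resulting convex $(n+3)$-gon let $R_\delta(\sigma)$ be the set of vertices strictly below the line through $i$ and $j$, and let $S_\delta(\sigma)\subset\{1,\dots,n+1\}$ be obtained from $R_\delta(\sigma)$ by replacing $0$ by $i$ if $0\in R_\delta(\sigma)$, and $n+2$ by $j$ if $n+2\in R_\delta(\sigma)$. The Hohlweg--Lange associahedron is the $n$-dimensional polytope $$\mathrm{Ass}^{I}_n(\sigma)=\Big\{x\in\mathbb R^{n+1}:\ \sum_{k\in S_\delta(\sigma)}x_k\ \ge\ \tfrac12|S_\delta(\sigma)|\,(|S_\delta(\sigma)|+1)\ \text{ for all diagonals }\delta,\quad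 x_1+\dots+x_{n+1}=\tfrac{(n+1)(n+2)}2\Big\}.$$ Two polytopes $P$ and $Q$ are called normally isomorphic if there is a linear isomorphism between the vector spaces containing their normal fans which carries the cones of the normal fan of $P$ to the cones of the normal fan of $Q$. Here the normal fan of a polytope $P$ is the set of the normal cones of its nonempty faces, regarded in the dual of the linear space parallel to the affine hull of $P$ (so that for $\mathrm{Ass}^{I}_n(\sigma)$ normal vectors are taken modulo $(1,\dots,1)$). Two subsets of a Euclidean space are called isometric if an isometry of the space maps one onto the other. Proposition. For all $n\ge1$ and all $\sigma,\sigma'\in\{+,-\}^{n-1}$, the Hohlweg--Lange associahedra $\mathrm{Ass}^{I}_n(\sigma)$ and $\mathrm{Ass}^{I}_n(\sigma')$ are normally isomorphic if and only if they are isometric. -/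

import Mathlib

/-! ### Normal fans of polytopes and normal isomorphism -/

/-- The (closed) normal cone of a face `F` of a polytope `P`: all linear functionals on the
linear space parallel to the affine hull of `P` whose maximum over `P` is attained at all
points of `F`. For an `n`-dimensional polytope it lives in an `n`-dimensional space, also if
`P` is embedded in a space of larger dimension: functionals of the ambient space that agree on
`vectorSpan ℝ P` are identified. -/
def normalCone {V : Type*} [NormedAddCommGroup V] [NormedSpace ℝ V] (P F : Set V) :
    Set (Module.Dual ℝ (vectorSpan ℝ P)) :=
  {f | ∀ x ∈ F, ∀ v : vectorSpan ℝ P, x + (v : V) ∈ P → f v ≤ 0}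

/-- The normal fan of a polytope: the set of the normal cones of its nonempty faces
(the faces of a polytope are its exposed faces, `P` itself included). -/
def normalFan {V : Type*} [NormedAddCommGroup V] [NormedSpace ℝ V] (P : Set V) :
    Set (Set (Module.Dual ℝ (vectorSpan ℝ P))) :=
  {C | ∃ F : Set V, F.Nonempty ∧ IsExposed ℝ P F ∧ C = normalCone P F}

/-- Two fans are linearly isomorphic if some linear isomorphism of the surrounding spaces
carries the cones of the first to the cones of the second. -/
def LinearlyIsomorphicFans {U W : Type*} [AddCommGroup U] [Module ℝ U]
    [AddCommGroup W] [Module ℝ W] (𝓕 : Set (Set U)) (𝓖 : Set (Set W)) : Prop :=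
  ∃ φ : U ≃ₗ[ℝ] W, (fun C : Set U => φ '' C) '' 𝓕 = 𝓖

/-- Two polytopes are normally isomorphic if their normal fans are linearly isomorphic. -/
def NormallyIsomorphic {V W : Type*} [NormedAddCommGroup V] [NormedSpace ℝ V]
    [NormedAddCommGroup W] [NormedSpace ℝ W] (P : Set V) (Q : Set W) : Prop :=
  LinearlyIsomorphicFans (normalFan P) (normalFan Q)

/-- Two subsets of a Euclidean space are isometric (congruent) if some isometry of the space
maps the first onto the second. -/
def IsometricSets {V : Type*} [NormedAddCommGroup V] [NormedSpace ℝ V] (P Q : Set V) : Prop :=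
  ∃ g : V ≃ᵢ V, g '' P = Q

/-! ### The Hohlweg--Lange associahedra -/

namespace HohlwegLange

/-- The sequence `(+, -, σ, -, +)`, indexed by the labels `0, 1, …, n + 2`. -/
def extSign {n : ℕ} (σ : Fin (n - 1) → ℤˣ) (k : Fin (n + 3)) : ℤˣ :=
  if h : 2 ≤ (k : ℕ) ∧ (k : ℕ) ≤ n then σ ⟨(k : ℕ) - 2, by omega⟩
  else if (k : ℕ) = 0 ∨ (k : ℕ) = n + 2 then 1 else -1

/-- The first coordinate of the vertex `k` of the polygon: the vertices are placed from left
to right. -/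
def vertexX {n : ℕ} (k : Fin (n + 3)) : ℤ := ((k : ℕ) : ℤ)

/-- The second coordinate of the vertex `k` of the polygon. Positive vertices lie on the
parabola `y = (x + 1) (n + 3 - x)`, above the horizontal axis, and negative vertices on the
parabola `y = - (x + 1) (n + 3 - x)`, below it. All vertices have `-1 < x < n + 3`, so they are
in (strictly) convex position. -/
def vertexY {n : ℕ} (σ : Fin (n - 1) → ℤˣ) (k : Fin (n + 3)) : ℤ :=
  (extSign σ k : ℤ) * ((vertexX k + 1) * ((n : ℤ) + 3 - vertexX k))

/-- For `i < j`, the vertex `k` lies strictly below the line through the vertices `i`, `j`. -/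
def IsBelow {n : ℕ} (σ : Fin (n - 1) → ℤˣ) (i j k : Fin (n + 3)) : Prop :=
  (vertexX j - vertexX i) * (vertexY σ k - vertexY σ i) <
    (vertexY σ j - vertexY σ i) * (vertexX k - vertexX i)

instance {n : ℕ} (σ : Fin (n - 1) → ℤˣ) (i j k : Fin (n + 3)) : Decidable (IsBelow σ i j k) :=
  inferInstanceAs (Decidable (_ < _))

/-- For `i < j`, the vertex `k` lies strictly above the line through the vertices `i`, `j`. -/
def IsAbove {n : ℕ} (σ : Fin (n - 1) → ℤˣ) (i j k : Fin (n + 3)) : Prop :=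
  (vertexY σ j - vertexY σ i) * (vertexX k - vertexX i) <
    (vertexX j - vertexX i) * (vertexY σ k - vertexY σ i)

/-- `ij` with `i < j` is a diagonal (not an edge) of the convex polygon: there are vertices
strictly on both sides of it. -/
def IsDiagonal {n : ℕ} (σ : Fin (n - 1) → ℤˣ) (i j : Fin (n + 3)) : Prop :=
  i < j ∧ (∃ k, IsBelow σ i j k) ∧ ∃ k, IsAbove σ i j k

/-- `R_{ij}(σ)`: the set of vertices strictly below the diagonal `ij`. -/
def belowSet {n : ℕ} (σ : Fin (n - 1) → ℤˣ) (i j : Fin (n + 3)) : Finset (Fin (n + 3)) :=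
  Finset.univ.filter fun k => IsBelow σ i j k

/-- `S_{ij}(σ)`: the result of replacing `0` by `i` and `n + 2` by `j` in `R_{ij}(σ)`. It is a
subset of `{1, …, n + 1}`; the element `c : Fin (n + 1)` stands for the label `c + 1`. -/
def normalSet {n : ℕ} (σ : Fin (n - 1) → ℤˣ) (i j : Fin (n + 3)) : Finset (Fin (n + 1)) :=
  Finset.univ.filter fun c => c.succ.castSucc ∈
    (belowSet σ i j).image fun k => if k = 0 then i else if k = Fin.last (n + 2) then j else k

/-- The Hohlweg--Lange associahedron of the sign sequence `σ ∈ {+, -}^(n-1)`, in `ℝ^(n+1)`. -/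
def associahedron {n : ℕ} (σ : Fin (n - 1) → ℤˣ) : Set (EuclideanSpace ℝ (Fin (n + 1))) :=
  {x | (∀ i j : Fin (n + 3), IsDiagonal σ i j →
        ((normalSet σ i j).card : ℝ) * (((normalSet σ i j).card : ℝ) + 1) / 2 ≤
          ∑ c ∈ normalSet σ i j, x c) ∧
      ∑ c, x c = ((n : ℝ) + 1) * ((n : ℝ) + 2) / 2}

end HohlwegLange

/-! An isometry is affine, so the transpose of the inverse of its linear part carries normal cones
to normal cones. Only the converse has content.

The associahedron is the permutahedron with some inequalities dropped; the kept ones belong to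
nonempty proper subsets `S`. Each of them defines a facet, because `facetPoint S` makes it tight and
all others strict. Hence the rays of the normal fan are spanned by the negated indicator vectors of
the kept sets modulo (1, …, 1), and an isomorphism of fans matches these rays. In the basis of
initial-segment sums an indicator vector becomes `switchVector S`, whose entries -1, 0, 1 record
where membership changes.

Two kept sets are complementary only if they are an initial segment and its complement, with vectors
±e_k. So the isomorphism sends each e_k to a multiple of some e_m. Normals of the form e_b - e_a
force equal multipliers at a and b, and they occur, in one direction, for all consecutive indices;
up to positive scale the map is therefore a permutation times a global sign. The digraph of these
normals is read off from the signs of the vertices, and its edges that are not composites of two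
edges are exactly those between consecutive indices. So the permutation is the identity or the
reversal. In each of the four cases the kept sets correspond under complementation, reversal, both
or neither, and these operations come from isometries of the space. -/

/-! ### Isometric sets have isomorphic normal fans. -/

/-- An affine bijection with linear part `L` that maps `P` onto `Q` carries the cones of the
normal fan of `P` to cones of the normal fan of `Q`. -/
theorem image_dualMap_mem_normalFan {V : Type*} [NormedAddCommGroup V] [NormedSpace ℝ V]
    {P Q : Set V} (g : V ≃ V) (L : V ≃L[ℝ] V) (hg : ∀ x v, g (x + v) = g x + L v)
    (hPQ : g '' P = Q) (M : vectorSpan ℝ P ≃ₗ[ℝ] vectorSpan ℝ Q)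
    (hM : ∀ v, (M v : V) = L v) {C : Set (Module.Dual ℝ (vectorSpan ℝ P))}
    (hC : C ∈ normalFan P) : (fun f => M.symm.dualMap f) '' C ∈ normalFan Q := by
  obtain ⟨F, hF, hE, rfl⟩ := hC
  have hg' : ∀ x, g x = g 0 + L x := fun x => by simpa using hg 0 x
  have hMs : ∀ w, ((M.symm w : vectorSpan ℝ P) : V) = L.symm w := fun w => by
    rw [ContinuousLinearEquiv.eq_symm_apply, ← hM, LinearEquiv.apply_symm_apply]
  refine ⟨g '' F, hF.image _, ?_, ?_⟩
  · intro _
    obtain ⟨l, rfl⟩ := hE hF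
    refine ⟨l.comp (L.symm : V →L[ℝ] V), ?_⟩
    subst hPQ
    have key : ∀ x y, (l.comp (L.symm : V →L[ℝ] V)) (g y) ≤
        (l.comp (L.symm : V →L[ℝ] V)) (g x) ↔ l y ≤ l x := fun x y => by
      rw [hg' x, hg' y]
      simp
    ext z
    constructor
    · rintro ⟨x, ⟨hx, hx'⟩, rfl⟩
      refine ⟨⟨x, hx, rfl⟩, ?_⟩
      rintro _ ⟨y, hy, rfl⟩
      exact (key x y).2 (hx' y hy)
    · rintro ⟨⟨x, hx, rfl⟩, h⟩
      exact ⟨x, ⟨hx, fun y hy => (key x y).1 (h _ ⟨y, hy, rfl⟩)⟩, rfl⟩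
  · ext f
    constructor
    · rintro ⟨f, hf, rfl⟩
      rintro _ ⟨x, hx, rfl⟩ w hw
      refine hf x hx (M.symm w) ?_
      subst hPQ
      obtain ⟨y, hy, hyw⟩ := hw
      have : y = x + (M.symm w : vectorSpan ℝ P) := by
        apply g.injective
        rw [hyw, hg, hMs, ContinuousLinearEquiv.apply_symm_apply]
      rwa [← this]
    · intro hf
      refine ⟨M.dualMap f, ?_, ?_⟩
      · intro x hx v hv
        refine hf (g x) ⟨x, hx, rfl⟩ (M v) ?_
        rw [hM, ← hg, ← hPQ]
        exact ⟨_, hv, rfl⟩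
      · ext w
        simp

/-- By the Mazur–Ulam theorem the isometry is affine; its linear part restricts to the directions of
the two sets, and the isomorphism of fans is the dual of the inverse of that restriction. -/
theorem IsometricSets.normallyIsomorphic {V : Type*} [NormedAddCommGroup V] [NormedSpace ℝ V]
    {P Q : Set V} (h : IsometricSets P Q) : NormallyIsomorphic P Q := by
  obtain ⟨g, hPQ⟩ := h
  set A := g.toRealAffineIsometryEquiv with hA
  have hAg : ∀ x, A x = g x := fun x => rfl
  set L : V ≃L[ℝ] V := A.linearIsometryEquiv.toContinuousLinearEquiv with hL
  have hg : ∀ x v, g (x + v) = g x + L v := fun x v => by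
    have := A.map_vadd x v
    simp only [vadd_eq_add] at this
    rw [add_comm, ← hAg, this, add_comm]
    rfl
  have hgs : ∀ x v, g.symm (x + v) = g.symm x + L.symm v := fun x v => by
    apply g.injective
    rw [hg]
    simp
  have hspan : Submodule.map (L.toLinearEquiv : V →ₗ[ℝ] V) (vectorSpan ℝ P) = vectorSpan ℝ Q := by
    rw [← hPQ]
    exact AffineMap.map_vectorSpan (A.toAffineEquiv : V →ᵃ[ℝ] V)
  set M := L.toLinearEquiv.ofSubmodules _ _ hspan with hMdef
  have hM : ∀ v, (M v : V) = L v := fun v => rfl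
  have hMs : ∀ w, (M.symm w : V) = L.symm w := fun w => rfl
  have hQP : g.symm '' Q = P := by
    rw [← hPQ, ← Set.image_comp]
    simp
  refine ⟨M.symm.dualMap, Set.Subset.antisymm ?_ ?_⟩
  · rintro _ ⟨C, hC, rfl⟩
    exact image_dualMap_mem_normalFan g.toEquiv L hg hPQ M hM hC
  · intro D hD
    refine ⟨_, image_dualMap_mem_normalFan g.symm.toEquiv L.symm hgs hQP M.symm hMs hD, ?_⟩
    simp only [← Set.image_comp]
    convert Set.image_id D
    ext f
    simp

/-! ### Removahedra: facets and rays of the normal fan. -/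

/-- The polyhedron given by the inequalities of the permutahedron that belong to the subsets
in `𝓕`. -/
def removahedron {n : ℕ} (𝓕 : Set (Finset (Fin (n + 1)))) : Set (EuclideanSpace ℝ (Fin (n + 1))) :=
  {x | (∀ S ∈ 𝓕, (S.card : ℝ) * ((S.card : ℝ) + 1) / 2 ≤ ∑ c ∈ S, x c) ∧
    ∑ c, x c = ((n : ℝ) + 1) * ((n : ℝ) + 2) / 2}

/-- The centroid of the facet of the permutahedron that belongs to `S`. -/
noncomputable def facetPoint {n : ℕ} (S : Finset (Fin (n + 1))) : EuclideanSpace ℝ (Fin (n + 1)) :=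
  WithLp.toLp 2 fun c => if c ∈ S then ((S.card : ℝ) + 1) / 2 else ((n : ℝ) + S.card + 2) / 2

theorem sum_facetPoint {n : ℕ} (S T : Finset (Fin (n + 1))) :
    ∑ c ∈ T, facetPoint S c = ((T ∩ S).card : ℝ) * (((S.card : ℝ) + 1) / 2) +
      ((T \ S).card : ℝ) * (((n : ℝ) + S.card + 2) / 2) := by
  simp only [facetPoint]
  rw [Finset.sum_ite, Finset.sum_const, Finset.sum_const, Finset.filter_mem_eq_inter,
    Finset.filter_notMem_eq_sdiff]
  simp

/-- With a = |T ∩ S|, b = |T \ S| and s = |S|, twice the gap is a(s - a) + b(n + 1 - s - b) + 2b(s -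
a). All factors are nonnegative, and the sum vanishes only for T empty, equal to S or full. -/
theorem card_lt_sum_facetPoint {n : ℕ} {S T : Finset (Fin (n + 1))} (h0 : T ≠ ∅) (hS : T ≠ S)
    (h1 : T ≠ Finset.univ) :
    (T.card : ℝ) * ((T.card : ℝ) + 1) / 2 < ∑ c ∈ T, facetPoint S c := by
  rw [sum_facetPoint]
  have hab : T.card = (T ∩ S).card + (T \ S).card := (Finset.card_inter_add_card_sdiff T S).symm
  have has : (T ∩ S).card ≤ S.card := Finset.card_le_card Finset.inter_subset_right
  have hun : (T ∪ S).card = S.card + (T \ S).card := by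
    rw [← Finset.card_sdiff_add_card, add_comm]
  have hb : S.card + (T \ S).card ≤ n + 1 := by
    rw [← hun]; simpa using Finset.card_le_univ (T ∪ S)
  have hT0 : 0 < T.card := Finset.card_pos.2 (Finset.nonempty_iff_ne_empty.2 h0)
  have hTn : T.card < n + 1 := by
    simpa using Finset.card_lt_univ_of_notMem (Classical.choose_spec
      (not_forall.1 fun h => h1 (Finset.eq_univ_iff_forall.2 h)))
  have hST : (T ∩ S).card = S.card → 0 < (T \ S).card := fun h => by
    have hsub : S ⊆ T := by
      have := Finset.eq_of_subset_of_card_le (Finset.inter_subset_right (s₁ := T) (s₂ := S)) h.ge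
      rw [← this]; exact Finset.inter_subset_left
    rw [Finset.card_pos, Finset.sdiff_nonempty]
    exact fun h' => hS (h'.antisymm hsub)
  rw [hab] at *
  generalize (T ∩ S).card = a at *
  generalize (T \ S).card = b at *
  generalize S.card = s at *
  have key : 0 < a * (s - a : ℝ) + b * (n + 1 - s - b : ℝ) + 2 * b * (s - a : ℝ) := by
    have e1 : (0 : ℝ) ≤ a := by positivity
    have e2 : (0 : ℝ) ≤ b := by positivity
    have e3 : (0 : ℝ) ≤ s - a := sub_nonneg.2 (by exact_mod_cast has)
    have e4 : (0 : ℝ) ≤ n + 1 - s - b := by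
      have : (s : ℝ) + b ≤ n + 1 := by exact_mod_cast hb
      linarith
    rcases has.lt_or_eq with h | h
    · have e5 : (0 : ℝ) < s - a := sub_pos.2 (by exact_mod_cast h)
      rcases Nat.eq_zero_or_pos a with h' | h'
      · have e6 : (0 : ℝ) < b := by
          have : 0 < b := by omega
          exact_mod_cast this
        positivity
      · have e6 : (0 : ℝ) < a := by exact_mod_cast h'
        positivity
    · have e5 : (0 : ℝ) < b := by exact_mod_cast hST h
      have e6 : (0 : ℝ) < n + 1 - s - b := by
        have : (s : ℝ) + b < n + 1 := by
          have : s + b < n + 1 := by omega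
          exact_mod_cast this
        linarith
      positivity
  push_cast
  nlinarith [key]

theorem sum_facetPoint_self {n : ℕ} (S : Finset (Fin (n + 1))) :
    ∑ c ∈ S, facetPoint S c = (S.card : ℝ) * ((S.card : ℝ) + 1) / 2 := by
  rw [sum_facetPoint]
  simp
  ring

theorem sum_univ_facetPoint {n : ℕ} (S : Finset (Fin (n + 1))) :
    ∑ c, facetPoint S c = ((n : ℝ) + 1) * ((n : ℝ) + 2) / 2 := by
  rw [sum_facetPoint, Finset.univ_inter, ← Finset.compl_eq_univ_sdiff, Finset.card_compl,
    Nat.cast_sub (Finset.card_le_univ S)]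
  simp
  ring

theorem facetPoint_mem_removahedron {n : ℕ} (𝓕 : Set (Finset (Fin (n + 1))))
    (S : Finset (Fin (n + 1))) : facetPoint S ∈ removahedron 𝓕 := by
  refine ⟨fun T _ => ?_, sum_univ_facetPoint S⟩
  by_cases h0 : T = ∅
  · simp [h0]
  by_cases hS : T = S
  · rw [hS, sum_facetPoint_self]
  by_cases h1 : T = Finset.univ
  · rw [h1, sum_univ_facetPoint]
    simp
    apply le_of_eq
    ring
  exact (card_lt_sum_facetPoint h0 hS h1).le

theorem convex_removahedron {n : ℕ} (𝓕 : Set (Finset (Fin (n + 1)))) :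
    Convex ℝ (removahedron 𝓕) := by
  intro x hx y hy a b ha hb hab
  refine ⟨fun S hS => ?_, ?_⟩
  · have h1 := mul_le_mul_of_nonneg_left (hx.1 S hS) ha
    have h2 := mul_le_mul_of_nonneg_left (hy.1 S hS) hb
    simp only [PiLp.add_apply, PiLp.smul_apply, smul_eq_mul, Finset.sum_add_distrib,
      ← Finset.mul_sum]
    calc _ = (a + b) * ((S.card : ℝ) * ((S.card : ℝ) + 1) / 2) := by rw [hab, one_mul]
      _ ≤ _ := by rw [add_mul]; exact add_le_add h1 h2
  · simp only [PiLp.add_apply, PiLp.smul_apply, smul_eq_mul, Finset.sum_add_distrib,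
      ← Finset.mul_sum, hx.2, hy.2]
    rw [← add_mul, hab, one_mul]

/-- From a point of a removahedron one can move a little in every direction of coordinate sum
zero that does not violate an inequality which is tight at this point. -/
theorem exists_add_smul_mem_removahedron {n : ℕ} {𝓕 : Set (Finset (Fin (n + 1)))}
    {x v : EuclideanSpace ℝ (Fin (n + 1))} (hx : x ∈ removahedron 𝓕) (hv : ∑ c, v c = 0)
    (h : ∀ S ∈ 𝓕, (S.card : ℝ) * ((S.card : ℝ) + 1) / 2 < ∑ c ∈ S, x c ∨ 0 ≤ ∑ c ∈ S, v c) :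
    ∃ t : ℝ, 0 < t ∧ x + t • v ∈ removahedron 𝓕 := by
  have key : ∀ S : Finset (Fin (n + 1)), ∀ᶠ t : ℝ in nhdsWithin 0 (Set.Ioi 0), S ∈ 𝓕 →
      (S.card : ℝ) * ((S.card : ℝ) + 1) / 2 ≤ ∑ c ∈ S, x c + t * ∑ c ∈ S, v c := by
    intro S
    by_cases hS : S ∈ 𝓕
    · rcases h S hS with h | h
      · have hc : Filter.Tendsto (fun t : ℝ => ∑ c ∈ S, x c + t * ∑ c ∈ S, v c)
            (nhdsWithin 0 (Set.Ioi 0)) (nhds (∑ c ∈ S, x c)) := by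
          have : Continuous fun t : ℝ => ∑ c ∈ S, x c + t * ∑ c ∈ S, v c := by fun_prop
          have h0 := this.tendsto 0
          simp only [zero_mul, add_zero] at h0
          exact h0.mono_left nhdsWithin_le_nhds
        filter_upwards [hc.eventually (lt_mem_nhds h)] with t ht _ using ht.le
      · filter_upwards [self_mem_nhdsWithin] with t ht _
        exact (hx.1 S hS).trans (le_add_of_nonneg_right (mul_nonneg (le_of_lt ht) h))
    · exact Filter.Eventually.of_forall fun t h' => absurd h' hS
  have hall := (Filter.eventually_all.2 key).and (self_mem_nhdsWithin (a := (0 : ℝ)))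
  obtain ⟨t, ht, ht0⟩ := hall.exists
  refine ⟨t, ht0, fun S hS => ?_, ?_⟩
  · simpa [Finset.sum_add_distrib, Finset.mul_sum] using ht S hS
  · simp [Finset.sum_add_distrib, ← Finset.mul_sum, hv, hx.2]

/-- The sum of the coordinates in `S`. -/
noncomputable def coordSum {n : ℕ} (S : Finset (Fin (n + 1))) :
    EuclideanSpace ℝ (Fin (n + 1)) →L[ℝ] ℝ :=
  ∑ c ∈ S, EuclideanSpace.proj c

@[simp] theorem coordSum_apply {n : ℕ} (S : Finset (Fin (n + 1)))
    (x : EuclideanSpace ℝ (Fin (n + 1))) : coordSum S x = ∑ c ∈ S, x c := by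
  simp [coordSum]

/-- All members of `𝓕` are nonempty proper subsets. -/
def ProperSubsets {n : ℕ} (𝓕 : Set (Finset (Fin (n + 1)))) : Prop :=
  ∀ S ∈ 𝓕, S ≠ ∅ ∧ S ≠ Finset.univ

theorem vectorSpan_removahedron {n : ℕ} {𝓕 : Set (Finset (Fin (n + 1)))} (h𝓕 : ProperSubsets 𝓕) :
    vectorSpan ℝ (removahedron 𝓕) = LinearMap.ker (coordSum (n := n) Finset.univ).toLinearMap := by
  apply le_antisymm
  · rw [vectorSpan_def, Submodule.span_le]
    rintro _ ⟨x, hx, y, hy, rfl⟩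
    simp [hx.2, hy.2]
  · intro v hv
    have hv0 : ∑ c, v c = 0 := by simpa using hv
    -- `facetPoint ∅` is the centre, with all coordinates (n + 2)/2; no inequality is tight there,
    -- so every direction of sum zero is available.
    obtain ⟨t, ht, hm⟩ := exists_add_smul_mem_removahedron
      (facetPoint_mem_removahedron 𝓕 ∅) hv0
      fun S hS => Or.inl (card_lt_sum_facetPoint (h𝓕 S hS).1 (h𝓕 S hS).1 (h𝓕 S hS).2)
    have := vsub_mem_vectorSpan ℝ hm (facetPoint_mem_removahedron 𝓕 ∅)
    simp only [vsub_eq_sub, add_sub_cancel_left] at this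
    exact (Submodule.smul_mem_iff _ ht.ne').1 this

theorem sum_coe_vectorSpan_removahedron {n : ℕ} {𝓕 : Set (Finset (Fin (n + 1)))}
    (h𝓕 : ProperSubsets 𝓕) (v : vectorSpan ℝ (removahedron 𝓕)) :
    ∑ c, (v : EuclideanSpace ℝ (Fin (n + 1))) c = 0 := by
  have := (vectorSpan_removahedron h𝓕).le v.2
  simpa using this

/-- The sum of the coordinates in `S` as a functional on the direction of a set. -/
noncomputable def dirSum {n : ℕ} (P : Set (EuclideanSpace ℝ (Fin (n + 1)))) (S : Finset (Fin (n + 1))) :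
    Module.Dual ℝ (vectorSpan ℝ P) :=
  (coordSum S).toLinearMap.domRestrict _

@[simp] theorem dirSum_apply {n : ℕ} {P : Set (EuclideanSpace ℝ (Fin (n + 1)))}
    (S : Finset (Fin (n + 1))) (v : vectorSpan ℝ P) :
    dirSum P S v = ∑ c ∈ S, (v : EuclideanSpace ℝ (Fin (n + 1))) c := by
  simp [dirSum]

/-- The ray of the outer normal vector of an inequality belongs to the normal fan: it is the
normal cone of a facet. -/
theorem exists_face_normalCone_eq {n : ℕ} {𝓕 : Set (Finset (Fin (n + 1)))}
    (h𝓕 : ProperSubsets 𝓕) {S : Finset (Fin (n + 1))} (hS : S ∈ 𝓕) :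
    {f | ∃ t : ℝ, 0 ≤ t ∧ f = t • (-dirSum (removahedron 𝓕) S)} ∈
      normalFan (removahedron 𝓕) := by
  set P := removahedron 𝓕 with hP
  have hp := facetPoint_mem_removahedron 𝓕 S
  have hF : facetPoint S ∈ {x ∈ P | ∀ y ∈ P, (-coordSum S) y ≤ (-coordSum S) x} := by
    refine ⟨hp, fun y hy => ?_⟩
    have := hy.1 S hS
    simp only [neg_apply, coordSum_apply, neg_le_neg_iff]
    rw [sum_facetPoint_self]
    exact this
  refine ⟨_, ⟨_, hF⟩, fun _ => ⟨-coordSum S, rfl⟩, ?_⟩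
  ext f
  constructor
  · rintro ⟨t, ht, rfl⟩ x hx v hv
    have := hx.2 _ hv
    simp only [neg_apply, map_add, coordSum_apply] at this
    simp only [LinearMap.smul_apply, LinearMap.neg_apply, dirSum_apply, smul_eq_mul]
    exact mul_nonpos_of_nonneg_of_nonpos ht (by linarith)
  · intro hf
    -- Only the inequality of `S` is tight at the facet point, so `f` is nonpositive on a whole
    -- half-space. It is then a nonpositive multiple of `dirSum P S`, with the factor read off at a
    -- vector `w` where `dirSum P S` is 1.
    have hle : ∀ v : vectorSpan ℝ P, 0 ≤ dirSum P S v → f v ≤ 0 := by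
      intro v hv
      have hv0 := sum_coe_vectorSpan_removahedron h𝓕 v
      obtain ⟨t, ht, hm⟩ := exists_add_smul_mem_removahedron hp hv0 fun T hT => by
        by_cases hTS : T = S
        · right; rw [hTS]; simpa using hv
        · exact Or.inl (card_lt_sum_facetPoint (h𝓕 T hT).1 hTS (h𝓕 T hT).2)
      have h2 := hf _ hF (t • v) hm
      rw [map_smul, smul_eq_mul] at h2
      exact nonpos_of_mul_nonpos_right h2 ht
    obtain ⟨a, ha⟩ := Finset.nonempty_iff_ne_empty.2 (h𝓕 S hS).1
    obtain ⟨b, hb⟩ := not_forall.1 fun h => (h𝓕 S hS).2 (Finset.eq_univ_iff_forall.2 h)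
    set w : EuclideanSpace ℝ (Fin (n + 1)) :=
      EuclideanSpace.single a 1 - EuclideanSpace.single b 1 with hw
    have hwm : w ∈ vectorSpan ℝ P := by
      rw [hP, vectorSpan_removahedron h𝓕]
      simp [hw]
    have hw1 : dirSum P S ⟨w, hwm⟩ = 1 := by
      simp [hw, ha, hb]
    refine ⟨-f ⟨w, hwm⟩, neg_nonneg.2 (hle _ (by rw [hw1]; exact zero_le_one)), ?_⟩
    ext v
    set u := v - dirSum P S v • (⟨w, hwm⟩ : vectorSpan ℝ P) with hu
    have hu0 : dirSum P S u = 0 := by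
      rw [hu, map_sub, map_smul, hw1]; simp
    have h1 := hle u hu0.ge
    have h2 := hle (-u) (by rw [map_neg, hu0, neg_zero])
    rw [map_neg] at h2
    have h3 : f u = 0 := by linarith
    rw [hu, map_sub, map_smul, smul_eq_mul] at h3
    simp only [LinearMap.smul_apply, LinearMap.neg_apply, smul_eq_mul]
    linarith

/-- A cone of the normal fan of a removahedron that contains none of the facet normals is
trivial. -/
theorem exists_neg_dirSum_mem_of_mem_normalFan {n : ℕ} {𝓕 : Set (Finset (Fin (n + 1)))}
    (h𝓕 : ProperSubsets 𝓕) {C : Set (Module.Dual ℝ (vectorSpan ℝ (removahedron 𝓕)))}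
    (hC : C ∈ normalFan (removahedron 𝓕)) {f : Module.Dual ℝ (vectorSpan ℝ (removahedron 𝓕))}
    (hf : f ∈ C) (hf0 : f ≠ 0) : ∃ S ∈ 𝓕, -dirSum (removahedron 𝓕) S ∈ C := by
  obtain ⟨F, hF, hE, rfl⟩ := hC
  by_contra! hno
  have hconv : Convex ℝ F := hE.convex (convex_removahedron 𝓕)
  have hsub : F ⊆ removahedron 𝓕 := hE.subset
  have hpt : ∀ S ∈ 𝓕, ∃ x ∈ F, (S.card : ℝ) * ((S.card : ℝ) + 1) / 2 < ∑ c ∈ S, x c := by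
    intro S hS
    have := hno S hS
    simp only [normalCone, Set.mem_ofPred_eq, not_forall, not_le] at this
    obtain ⟨x, hx, v, hv, hlt⟩ := this
    refine ⟨x, hx, ?_⟩
    have h1 := hv.1 S hS
    simp only [PiLp.add_apply, Finset.sum_add_distrib] at h1
    rw [LinearMap.neg_apply, dirSum_apply] at hlt
    linarith
  -- Midpoints keep strict what is strict at either end, so one point of `F` makes all inequalities
  -- strict. There `f` is nonpositive in every direction, hence zero.
  have hstrict : ∃ x ∈ F, ∀ S ∈ 𝓕, (S.card : ℝ) * ((S.card : ℝ) + 1) / 2 < ∑ c ∈ S, x c := by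
    have : ∀ 𝓖 : Set (Finset (Fin (n + 1))), 𝓖 ⊆ 𝓕 → ∃ x ∈ F, ∀ S ∈ 𝓖,
        (S.card : ℝ) * ((S.card : ℝ) + 1) / 2 < ∑ c ∈ S, x c := by
      intro 𝓖
      refine Set.Finite.induction_on 𝓖 𝓖.toFinite ?_ ?_
      · intro _
        obtain ⟨x, hx⟩ := hF
        exact ⟨x, hx, by simp⟩
      · intro T 𝓗 _ _ ih hT
        obtain ⟨x, hx, hxs⟩ := ih ((Set.subset_insert _ _).trans hT)
        obtain ⟨y, hy, hys⟩ := hpt T (hT (Set.mem_insert _ _))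
        refine ⟨(1 / 2 : ℝ) • x + (1 / 2 : ℝ) • y,
          hconv hx hy (by norm_num) (by norm_num) (by norm_num), fun S hS => ?_⟩
        have h1 := (hsub hx).1 S (hT hS)
        have h2 := (hsub hy).1 S (hT hS)
        simp only [PiLp.add_apply, PiLp.smul_apply, smul_eq_mul, Finset.sum_add_distrib,
          ← Finset.mul_sum]
        rcases hS with rfl | hS
        · linarith
        · linarith [hxs S hS]
    exact this 𝓕 subset_rfl
  obtain ⟨x, hx, hxs⟩ := hstrict
  have hle : ∀ v, f v ≤ 0 := by
    intro v
    have hv0 := sum_coe_vectorSpan_removahedron h𝓕 v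
    obtain ⟨t, ht, hm⟩ := exists_add_smul_mem_removahedron (hsub hx) hv0
      fun S hS => Or.inl (hxs S hS)
    have h2 := hf _ hx (t • v) hm
    rw [map_smul, smul_eq_mul] at h2
    exact nonpos_of_mul_nonpos_right h2 ht
  apply hf0
  ext v
  have := hle (-v)
  rw [map_neg] at this
  exact le_antisymm (hle v) (by simpa using this)

/-! ### Coordinates of the normal vectors. -/

/-- The coordinates of the functional `∑ c ∈ S, x c`, modulo `∑ c, x c`, in the basis of the
sums over the proper initial segments. -/
noncomputable def switchVector {n : ℕ} (S : Finset (Fin (n + 1))) (k : Fin n) : ℝ :=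
  (if k.castSucc ∈ S then 1 else 0) - if k.succ ∈ S then 1 else 0

theorem switchVector_mem {n : ℕ} (S : Finset (Fin (n + 1))) (k : Fin n) :
    switchVector S k = -1 ∨ switchVector S k = 0 ∨ switchVector S k = 1 := by
  unfold switchVector
  split_ifs <;> norm_num

theorem switchVector_eq_zero_iff {n : ℕ} {S : Finset (Fin (n + 1))} {k : Fin n} :
    switchVector S k = 0 ↔ (k.castSucc ∈ S ↔ k.succ ∈ S) := by
  unfold switchVector
  split_ifs <;> simp_all

theorem switchVector_compl {n : ℕ} (S : Finset (Fin (n + 1))) (k : Fin n) :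
    switchVector Sᶜ k = -switchVector S k := by
  simp only [switchVector, Finset.mem_compl]
  split_ifs <;> norm_num

theorem switchVector_map_rev {n : ℕ} (S : Finset (Fin (n + 1))) (k : Fin n) :
    switchVector (S.map Fin.revPerm.toEmbedding) k = -switchVector S k.rev := by
  simp only [switchVector, Finset.mem_map_equiv, Fin.revPerm_symm, Fin.revPerm_apply,
    Fin.rev_castSucc, Fin.rev_succ]
  ring

theorem switchVector_Iic {n : ℕ} (k : Fin n) :
    switchVector (Finset.Iic k.castSucc) = Pi.single k 1 := by
  ext m
  simp only [switchVector, Finset.mem_Iic, Pi.single_apply, Fin.le_def, Fin.val_castSucc,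
    Fin.val_succ, Fin.ext_iff]
  split_ifs <;> first | omega | norm_num

/-- A telescoping sum, so its value is -1, 0 or 1; this is what later excludes two nonzero entries
of equal sign. -/
theorem sum_switchVector {n : ℕ} (S : Finset (Fin (n + 1))) :
    ∑ k, switchVector S k = (if 0 ∈ S then 1 else 0) - if Fin.last n ∈ S then 1 else 0 := by
  have h1 := Fin.sum_univ_castSucc fun c : Fin (n + 1) => if c ∈ S then (1 : ℝ) else 0
  have h2 := Fin.sum_univ_succ fun c : Fin (n + 1) => if c ∈ S then (1 : ℝ) else 0
  simp only [switchVector, Finset.sum_sub_distrib]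
  linarith

theorem Fin.eq_apply_zero_of_castSucc_eq_succ {n : ℕ} {α : Type*} {g : Fin (n + 1) → α}
    (h : ∀ k : Fin n, g k.castSucc = g k.succ) (c : Fin (n + 1)) : g c = g 0 := by
  induction c using Fin.induction with
  | zero => rfl
  | succ k ih => rw [← h, ih]

theorem exists_switchVector_ne_zero {n : ℕ} {S : Finset (Fin (n + 1))} (h0 : S ≠ ∅)
    (h1 : S ≠ Finset.univ) : ∃ k, switchVector S k ≠ 0 := by
  by_contra! h
  have hc := Fin.eq_apply_zero_of_castSucc_eq_succ (g := fun c => c ∈ S)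
    fun k => propext (switchVector_eq_zero_iff.1 (h k))
  by_cases hz : (0 : Fin (n + 1)) ∈ S
  · exact h1 (Finset.eq_univ_iff_forall.2 fun c => by rw [hc c]; exact hz)
  · exact h0 (Finset.eq_empty_iff_forall_notMem.2 fun c => by rw [hc c]; exact hz)

/-- Equal switches make the difference of the two indicator functions constant. A constant 1 would
make `S` full and a constant -1 would make it empty. -/
theorem switchVector_injective {n : ℕ} {S T : Finset (Fin (n + 1))} (hS0 : S ≠ ∅)
    (hS1 : S ≠ Finset.univ) (h : ∀ k, switchVector S k = switchVector T k) : S = T := by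
  have hc := Fin.eq_apply_zero_of_castSucc_eq_succ
    (g := fun c => (if c ∈ S then (1 : ℝ) else 0) - if c ∈ T then 1 else 0)
    fun k => by have := h k; unfold switchVector at this; linarith
  by_cases h1 : (0 : Fin (n + 1)) ∈ S <;> by_cases h2 : (0 : Fin (n + 1)) ∈ T <;>
    simp only [h1, h2, if_true, if_false] at hc
  · ext c
    have := hc c
    split_ifs at this <;> first | tauto | norm_num at this
  · refine absurd (Finset.eq_univ_iff_forall.2 fun c => ?_) hS1
    have := hc c
    split_ifs at this <;> first | assumption | norm_num at this
  · refine absurd (Finset.eq_empty_iff_forall_notMem.2 fun c h3 => ?_) hS0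
    have := hc c
    split_ifs at this <;> norm_num at this
  · ext c
    have := hc c
    split_ifs at this <;> first | tauto | norm_num at this

/-- The functionals on the direction of a removahedron have coordinates such that the sum over
`S` has the coordinates `switchVector S`. -/
theorem exists_dual_equiv {n : ℕ} {𝓕 : Set (Finset (Fin (n + 1)))} (h𝓕 : ProperSubsets 𝓕) :
    ∃ κ : Module.Dual ℝ (vectorSpan ℝ (removahedron 𝓕)) ≃ₗ[ℝ] (Fin n → ℝ),
      ∀ S, κ (dirSum _ S) = switchVector S := by
  have hmem : ∀ k : Fin n, EuclideanSpace.single k.castSucc (1 : ℝ) -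
      EuclideanSpace.single k.succ 1 ∈ vectorSpan ℝ (removahedron 𝓕) := fun k => by
    rw [vectorSpan_removahedron h𝓕]
    simp
  -- The coordinates are the values on e_k - e_{k+1}, the basis dual to the initial-segment sums.
  set κ : Module.Dual ℝ (vectorSpan ℝ (removahedron 𝓕)) →ₗ[ℝ] (Fin n → ℝ) :=
    LinearMap.pi fun k => Module.Dual.eval ℝ _ ⟨_, hmem k⟩ with hκ
  have hκS : ∀ S, κ (dirSum _ S) = switchVector S := fun S => by
    ext k
    simp [hκ, switchVector]
  have hsurj : Function.Surjective κ := fun a => by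
    refine ⟨∑ k, a k • dirSum _ (Finset.Iic k.castSucc), ?_⟩
    simp only [map_sum, map_smul, hκS, switchVector_Iic]
    ext m
    simp [Pi.single_apply]
  have hne : (coordSum (n := n) Finset.univ).toLinearMap ≠ 0 := fun h => by
    have := LinearMap.congr_fun h (EuclideanSpace.single 0 1)
    simp at this
  have hrank : Module.finrank ℝ (Module.Dual ℝ (vectorSpan ℝ (removahedron 𝓕))) =
      Module.finrank ℝ (Fin n → ℝ) := by
    have h1 := Module.Dual.finrank_ker_add_one_of_ne_zero hne
    rw [Subspace.dual_finrank_eq, vectorSpan_removahedron h𝓕]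
    simp only [finrank_euclideanSpace, Fintype.card_fin, Module.finrank_fin_fun] at h1 ⊢
    omega
  exact ⟨LinearEquiv.ofBijective κ
    ⟨(LinearMap.injective_iff_surjective_of_finrank_eq_finrank hrank).2 hsurj, hsurj⟩, hκS⟩

/-! ### From isomorphisms of fans to maps of rays. -/

/-- The linear map `ψ` maps the rays spanned by the vectors that belong to the members of `𝓕`
to such rays for `𝓖`. -/
def MapsRays {n : ℕ} (ψ : (Fin n → ℝ) ≃ₗ[ℝ] (Fin n → ℝ)) (𝓕 𝓖 : Set (Finset (Fin (n + 1)))) :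
    Prop :=
  ∀ S ∈ 𝓕, ∃ T ∈ 𝓖, ∃ r : ℝ, 0 < r ∧ ψ (switchVector S) = r • switchVector T

theorem dirSum_ne_zero {n : ℕ} {𝓕 : Set (Finset (Fin (n + 1)))} (h𝓕 : ProperSubsets 𝓕)
    {S : Finset (Fin (n + 1))} (hS : S ∈ 𝓕) : dirSum (removahedron 𝓕) S ≠ 0 := by
  obtain ⟨κ, hκ⟩ := exists_dual_equiv h𝓕
  obtain ⟨k, hk⟩ := exists_switchVector_ne_zero (h𝓕 S hS).1 (h𝓕 S hS).2
  intro h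
  rw [← hκ, h] at hk
  simp at hk

/-- The image of the ray of `S` is a nontrivial cone of the target fan, so it contains a facet
normal; as the image is a single ray, the two vectors are proportional. -/
theorem exists_map_dirSum_eq {n : ℕ} {𝓕 𝓖 : Set (Finset (Fin (n + 1)))} (h𝓕 : ProperSubsets 𝓕)
    (h𝓖 : ProperSubsets 𝓖) (φ : Module.Dual ℝ (vectorSpan ℝ (removahedron 𝓕)) ≃ₗ[ℝ]
      Module.Dual ℝ (vectorSpan ℝ (removahedron 𝓖)))
    (hφ : ∀ C ∈ normalFan (removahedron 𝓕), φ '' C ∈ normalFan (removahedron 𝓖))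
    {S : Finset (Fin (n + 1))} (hS : S ∈ 𝓕) :
    ∃ T ∈ 𝓖, ∃ r : ℝ, 0 < r ∧ φ (dirSum _ S) = r • dirSum _ T := by
  have hC := hφ _ (exists_face_normalCone_eq h𝓕 hS)
  obtain ⟨T, hT, f, ⟨t, ht, rfl⟩, hfT⟩ := exists_neg_dirSum_mem_of_mem_normalFan h𝓖 hC
    (f := φ (-dirSum _ S)) ⟨_, ⟨1, zero_le_one, (one_smul _ _).symm⟩, rfl⟩
    (by simpa using dirSum_ne_zero h𝓕 hS)
  have ht0 : t ≠ 0 := by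
    rintro rfl
    rw [zero_smul, map_zero, eq_comm, neg_eq_zero] at hfT
    exact dirSum_ne_zero h𝓖 hT hfT
  refine ⟨T, hT, t⁻¹, inv_pos.2 (lt_of_le_of_ne ht ht0.symm), ?_⟩
  rw [smul_neg, map_neg, neg_inj, map_smul] at hfT
  rw [← hfT, smul_smul, inv_mul_cancel₀ ht0, one_smul]

theorem NormallyIsomorphic.exists_mapsRays {n : ℕ} {𝓕 𝓖 : Set (Finset (Fin (n + 1)))}
    (h𝓕 : ProperSubsets 𝓕) (h𝓖 : ProperSubsets 𝓖)
    (h : NormallyIsomorphic (removahedron 𝓕) (removahedron 𝓖)) :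
    ∃ ψ : (Fin n → ℝ) ≃ₗ[ℝ] (Fin n → ℝ), MapsRays ψ 𝓕 𝓖 ∧ MapsRays ψ.symm 𝓖 𝓕 := by
  obtain ⟨φ, hφ⟩ := h
  obtain ⟨κ, hκ⟩ := exists_dual_equiv h𝓕
  obtain ⟨μ, hμ⟩ := exists_dual_equiv h𝓖
  refine ⟨κ.symm ≪≫ₗ φ ≪≫ₗ μ, fun S hS => ?_, fun T hT => ?_⟩
  · obtain ⟨T, hT, r, hr, h⟩ := exists_map_dirSum_eq h𝓕 h𝓖 φ
      (fun C hC => by rw [← hφ]; exact ⟨C, hC, rfl⟩) hS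
    refine ⟨T, hT, r, hr, ?_⟩
    rw [← hκ, LinearEquiv.trans_apply, LinearEquiv.trans_apply, LinearEquiv.symm_apply_apply, h,
      map_smul, hμ]
  · obtain ⟨S, hS, r, hr, h⟩ := exists_map_dirSum_eq h𝓖 h𝓕 φ.symm (fun D hD => by
      rw [← hφ] at hD
      obtain ⟨C, hC, rfl⟩ := hD
      simpa [← Set.image_comp] using hC) hT
    refine ⟨S, hS, r, hr, ?_⟩
    rw [LinearEquiv.symm_apply_eq, map_smul, ← hκ S, LinearEquiv.trans_apply,
      LinearEquiv.trans_apply, LinearEquiv.symm_apply_apply, ← hμ T, ← map_smul, ← map_smul, ← h,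
      LinearEquiv.apply_symm_apply]

/-! ### Rigidity of the ray configuration. -/

/-- There is an inequality whose normal vector is the difference of the basis vectors at `b`
and `a`. -/
def DiffEdge {n : ℕ} (𝓕 : Set (Finset (Fin (n + 1)))) (a b : Fin n) : Prop :=
  ∃ S ∈ 𝓕, switchVector S = Pi.single b 1 - Pi.single a 1

/-- The properties of the sets of inequalities of an associahedron by which its normal fan is
recognized; `low c` means that the vertex `c + 1` of the polygon is negative. -/
structure IsAssociahedral {n : ℕ} (𝓕 : Set (Finset (Fin (n + 1)))) (low : Fin n → Prop) :
    Prop where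
  proper : ProperSubsets 𝓕
  Iic_mem : ∀ k : Fin n, Finset.Iic k.castSucc ∈ 𝓕
  compl_Iic_mem : ∀ k : Fin n, (Finset.Iic k.castSucc)ᶜ ∈ 𝓕
  eq_Iic : ∀ S ∈ 𝓕, Sᶜ ∈ 𝓕 → ∃ k : Fin n, S = Finset.Iic k.castSucc ∨ Sᶜ = Finset.Iic k.castSucc
  edge_iff : ∀ a b, DiffEdge 𝓕 a b ↔
    (a < b ∧ ∀ c, a < c → c ≤ b → low c) ∨ (b < a ∧ ∀ c, b < c → c ≤ a → ¬ low c)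

section

variable {n : ℕ} {𝓕 𝓖 : Set (Finset (Fin (n + 1)))} {low low' : Fin n → Prop}

theorem eq_compl_of_smul_switchVector {S T : Finset (Fin (n + 1))} (hS0 : S ≠ ∅)
    (hS1 : S ≠ Finset.univ) {r t : ℝ} (hr : 0 < r) (ht : 0 < t)
    (h : r • switchVector S = -(t • switchVector T)) : T = Sᶜ := by
  obtain ⟨k, hk⟩ := exists_switchVector_ne_zero hS0 hS1
  have hp : ∀ m, r * switchVector S m = -(t * switchVector T m) := fun m => by
    simpa using congrFun h m
  have hrt : r = t := by
    have := hp k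
    rcases switchVector_mem S k with h1 | h1 | h1 <;>
      rcases switchVector_mem T k with h2 | h2 | h2 <;> rw [h1, h2] at this <;>
      first | exact absurd h1 hk | linarith
  subst hrt
  rw [eq_comm, compl_eq_comm]
  refine (switchVector_injective hS0 hS1 fun m => ?_).symm
  rw [switchVector_compl]
  have := hp m
  rw [← mul_neg] at this
  exact mul_left_cancel₀ hr.ne' this

/-- Opposite rays go to opposite rays, and in both configurations the opposite pairs are exactly the
coordinate axes. -/
theorem IsAssociahedral.exists_map_single (h𝓕 : IsAssociahedral 𝓕 low)
    (h𝓖 : IsAssociahedral 𝓖 low') {ψ : (Fin n → ℝ) ≃ₗ[ℝ] (Fin n → ℝ)} (hψ : MapsRays ψ 𝓕 𝓖)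
    (k : Fin n) : ∃ (m : Fin n) (r : ℝ), r ≠ 0 ∧ ψ (Pi.single k 1) = r • Pi.single m 1 := by
  obtain ⟨S, hS, r, hr, h1⟩ := hψ _ (h𝓕.Iic_mem k)
  obtain ⟨T, hT, t, ht, h2⟩ := hψ _ (h𝓕.compl_Iic_mem k)
  have h3 : switchVector (Finset.Iic k.castSucc)ᶜ = -switchVector (Finset.Iic k.castSucc) :=
    funext fun m => switchVector_compl _ m
  rw [h3, map_neg, h1] at h2
  have hTS : T = Sᶜ := eq_compl_of_smul_switchVector (h𝓖.proper S hS).1 (h𝓖.proper S hS).2 hr ht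
    (by rw [← h2, neg_neg])
  subst hTS
  rw [switchVector_Iic] at h1
  obtain ⟨m, hm | hm⟩ := h𝓖.eq_Iic S hS hT
  · exact ⟨m, r, hr.ne', by rw [h1, hm, switchVector_Iic]⟩
  · refine ⟨m, -r, neg_ne_zero.2 hr.ne', ?_⟩
    have h4 : switchVector S = -switchVector Sᶜ :=
      funext fun m => by simp [switchVector_compl]
    rw [h1, h4, hm, switchVector_Iic, smul_neg, neg_smul]

theorem switchVector_add_eq_zero {S : Finset (Fin (n + 1))} {a b : Fin n} (hab : a ≠ b)
    (ha : switchVector S a ≠ 0) (hb : switchVector S b ≠ 0)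
    (h : ∀ k, k ≠ a → k ≠ b → switchVector S k = 0) : switchVector S a + switchVector S b = 0 := by
  have h1 := sum_switchVector S
  rw [Fintype.sum_eq_add a b hab fun k hk => h k hk.1 hk.2] at h1
  rcases switchVector_mem S a with h2 | h2 | h2 <;>
    rcases switchVector_mem S b with h3 | h3 | h3 <;> rw [h2, h3] at h1 ⊢ <;>
    first | exact absurd h2 ha | exact absurd h3 hb | norm_num
  all_goals split_ifs at h1 <;> norm_num at h1

theorem DiffEdge.ne (h𝓕 : ProperSubsets 𝓕) {a b : Fin n} (h : DiffEdge 𝓕 a b) : a ≠ b := by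
  rintro rfl
  obtain ⟨S, hS, h⟩ := h
  obtain ⟨k, hk⟩ := exists_switchVector_ne_zero (h𝓕 S hS).1 (h𝓕 S hS).2
  rw [h, sub_self] at hk
  exact hk rfl

/-- A linear map between the normal fans of two associahedra is a multiple of a signed
permutation of the coordinates, with constant sign. -/
theorem IsAssociahedral.exists_perm (h𝓕 : IsAssociahedral 𝓕 low)
    (h𝓖 : IsAssociahedral 𝓖 low') {ψ : (Fin n → ℝ) ≃ₗ[ℝ] (Fin n → ℝ)} (hψ : MapsRays ψ 𝓕 𝓖) :
    ∃ (π : Equiv.Perm (Fin n)) (ρ : ℝ), ρ ≠ 0 ∧ ∀ u k, ψ u (π k) = ρ * u k := by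
  choose π r hr hπ using h𝓕.exists_map_single h𝓖 hψ
  have hinj : Function.Injective π := by
    intro a b hab
    by_contra hne
    have h1 : ψ (r b • Pi.single a 1 - r a • Pi.single b 1) = 0 := by
      rw [map_sub, map_smul, map_smul, hπ, hπ, hab, smul_smul, smul_smul, mul_comm, sub_self]
    rw [LinearEquiv.map_eq_zero_iff] at h1
    have h2 := congrFun h1 a
    simp only [Pi.sub_apply, Pi.smul_apply, Pi.single_eq_same, Pi.single_eq_of_ne hne,
      smul_eq_mul, mul_one, mul_zero, sub_zero, Pi.zero_apply] at h2
    exact hr b h2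
  -- The image of e_b - e_a is a positive multiple of a switch vector with exactly two nonzero
  -- entries, which must be opposite.
  have hedge : ∀ a b, DiffEdge 𝓕 a b → r a = r b := by
    intro a b hab
    have hne := hab.ne h𝓕.proper
    obtain ⟨S, hS, h⟩ := hab
    obtain ⟨T, hT, t, ht, hST⟩ := hψ S hS
    rw [h, map_sub, hπ, hπ] at hST
    have hval : ∀ m, t * switchVector T m = (r b • Pi.single (π b) 1 - r a • Pi.single (π a) 1 :
        Fin n → ℝ) m := fun m => by rw [hST]; rfl
    have hπne : π a ≠ π b := fun h => hne (hinj h)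
    have ha : t * switchVector T (π a) = -r a := by
      rw [hval]; simp [Pi.single_eq_of_ne hπne]
    have hb : t * switchVector T (π b) = r b := by
      rw [hval]; simp [Pi.single_eq_of_ne hπne.symm]
    have h0 := switchVector_add_eq_zero (S := T) hπne
      (fun h0 => hr a (by rw [h0, mul_zero] at ha; linarith))
      (fun h0 => hr b (by rw [h0, mul_zero] at hb; linarith)) fun k hka hkb => by
        have := hval k
        rw [Pi.sub_apply, Pi.smul_apply, Pi.smul_apply, Pi.single_eq_of_ne hka,
          Pi.single_eq_of_ne hkb, smul_zero, smul_zero, sub_zero] at this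
        exact (mul_eq_zero.1 this).resolve_left ht.ne'
    have : t * (switchVector T (π a) + switchVector T (π b)) = 0 := by rw [h0, mul_zero]
    linarith
  -- Consecutive indices k, k + 1 are always joined, in the direction dictated by `low` at k + 1.
  obtain ⟨ρ, hρ, hρr⟩ : ∃ ρ : ℝ, ρ ≠ 0 ∧ ∀ k, r k = ρ := by
    rcases Nat.eq_zero_or_pos n with rfl | hn
    · exact ⟨1, one_ne_zero, fun k => k.elim0⟩
    refine ⟨r ⟨0, hn⟩, hr _, fun k => ?_⟩
    obtain ⟨k, hk⟩ := k
    induction k with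
    | zero => rfl
    | succ k ih =>
      rw [← ih (by omega)]
      by_cases hl : low ⟨k + 1, hk⟩
      · refine (hedge ⟨k, by omega⟩ ⟨k + 1, hk⟩ ((h𝓕.edge_iff _ _).2
          (Or.inl ⟨Nat.lt_succ_self k, fun c h1 h2 => ?_⟩))).symm
        rwa [show c = ⟨k + 1, hk⟩ from Fin.ext (le_antisymm h2 h1)]
      · refine hedge ⟨k + 1, hk⟩ ⟨k, by omega⟩ ((h𝓕.edge_iff _ _).2
          (Or.inr ⟨Nat.lt_succ_self k, fun c h1 h2 => ?_⟩))
        rwa [show c = ⟨k + 1, hk⟩ from Fin.ext (le_antisymm h2 h1)]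
  refine ⟨Equiv.ofBijective π (Finite.injective_iff_bijective.1 hinj), ρ, hρ, fun u k => ?_⟩
  have := LinearMap.pi_apply_eq_sum_univ ψ.toLinearMap u
  rw [LinearEquiv.coe_coe] at this
  rw [this, Equiv.ofBijective_apply, Finset.sum_apply, Finset.sum_eq_single k]
  · have h1 : (fun j => if k = j then (1 : ℝ) else 0) = Pi.single k 1 := by
      ext j; simp [Pi.single_apply, eq_comm]
    rw [h1, Pi.smul_apply, hπ, hρr]
    simp [mul_comm]
  · intro j _ hj
    have h1 : (fun i => if j = i then (1 : ℝ) else 0) = Pi.single j 1 := by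
      ext i; simp [Pi.single_apply, eq_comm]
    rw [h1, Pi.smul_apply, hπ, Pi.smul_apply,
      Pi.single_eq_of_ne fun h => hj (hinj h).symm]
    simp
  · simp

theorem IsAssociahedral.exists_signed_perm (h𝓕 : IsAssociahedral 𝓕 low)
    (h𝓖 : IsAssociahedral 𝓖 low') {ψ : (Fin n → ℝ) ≃ₗ[ℝ] (Fin n → ℝ)} (hψ : MapsRays ψ 𝓕 𝓖)
    (hψ' : MapsRays ψ.symm 𝓖 𝓕) :
    ∃ (π : Equiv.Perm (Fin n)) (ε : ℝ), (ε = 1 ∨ ε = -1) ∧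
      (∀ S ∈ 𝓕, ∃ T ∈ 𝓖, ∀ k, switchVector T (π k) = ε * switchVector S k) ∧
      ∀ T ∈ 𝓖, ∃ S ∈ 𝓕, ∀ k, switchVector T (π k) = ε * switchVector S k := by
  obtain ⟨π, ρ, hρ, h⟩ := h𝓕.exists_perm h𝓖 hψ
  -- All nonzero entries have absolute value 1, so `t` is the absolute value of `ρ` and can be
  -- cancelled, leaving the sign.
  have key : ∀ S ∈ 𝓕, ∀ T ∈ 𝓖, ∀ t : ℝ, 0 < t →
      (∀ k, t * switchVector T (π k) = ρ * switchVector S k) →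
      ∀ k, switchVector T (π k) = SignType.sign ρ * switchVector S k := by
    intro S hS T hT t ht hk
    obtain ⟨m, hm⟩ := exists_switchVector_ne_zero (h𝓕.proper S hS).1 (h𝓕.proper S hS).2
    have hm2 := hk m
    rcases lt_or_gt_of_ne hρ with hneg | hpos
    · have : t = -ρ := by
        rcases switchVector_mem S m with h1 | h1 | h1 <;>
          rcases switchVector_mem T (π m) with h2 | h2 | h2 <;> rw [h1, h2] at hm2 <;>
          first | exact absurd h1 hm | linarith
      intro k
      have h3 := hk k
      rw [this, neg_mul, neg_eq_iff_eq_neg, ← mul_neg] at h3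
      rw [sign_neg hneg, mul_left_cancel₀ hρ h3]
      simp
    · have : t = ρ := by
        rcases switchVector_mem S m with h1 | h1 | h1 <;>
          rcases switchVector_mem T (π m) with h2 | h2 | h2 <;> rw [h1, h2] at hm2 <;>
          first | exact absurd h1 hm | linarith
      intro k
      have h3 := hk k
      rw [this] at h3
      rw [sign_pos hpos, mul_left_cancel₀ hρ h3]
      simp
  refine ⟨π, SignType.sign ρ, ?_, fun S hS => ?_, fun T hT => ?_⟩
  · rcases lt_or_gt_of_ne hρ with hneg | hpos
    · right; simp [sign_neg hneg]
    · left; simp [sign_pos hpos]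
  · obtain ⟨T, hT, t, ht, hST⟩ := hψ S hS
    refine ⟨T, hT, key S hS T hT t ht fun k => ?_⟩
    rw [← h, hST]
    rfl
  · obtain ⟨S, hS, t, ht, hST⟩ := hψ' T hT
    refine ⟨S, hS, key S hS T hT t⁻¹ (inv_pos.2 ht) fun k => ?_⟩
    rw [LinearEquiv.symm_apply_eq, map_smul] at hST
    rw [← h, hST, Pi.smul_apply, smul_eq_mul, inv_mul_cancel_left₀ ht.ne']

/-- The adjacent pairs are those which are joined by an edge without intermediate vertex. -/
theorem IsAssociahedral.adjacent_iff (h𝓕 : IsAssociahedral 𝓕 low) (a b : Fin n) :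
    (b : ℕ) = a + 1 ∨ (a : ℕ) = b + 1 ↔
      (DiffEdge 𝓕 a b ∧ ¬ ∃ c, DiffEdge 𝓕 a c ∧ DiffEdge 𝓕 c b) ∨
        (DiffEdge 𝓕 b a ∧ ¬ ∃ c, DiffEdge 𝓕 b c ∧ DiffEdge 𝓕 c a) := by
  have fwd : ∀ a b : Fin n, (b : ℕ) = a + 1 →
      (DiffEdge 𝓕 a b ∧ ¬ ∃ c, DiffEdge 𝓕 a c ∧ DiffEdge 𝓕 c b) ∨
        (DiffEdge 𝓕 b a ∧ ¬ ∃ c, DiffEdge 𝓕 b c ∧ DiffEdge 𝓕 c a) := by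
    intro a b hab
    have hlt : a < b := by rw [Fin.lt_def]; omega
    have huniq : ∀ c, a < c → c ≤ b → c = b := fun c h1 h2 => by
      rw [Fin.lt_def] at h1; rw [Fin.le_def] at h2; apply Fin.ext; omega
    simp only [h𝓕.edge_iff]
    by_cases hl : low b
    · refine Or.inl ⟨Or.inl ⟨hlt, fun c h1 h2 => by rwa [huniq c h1 h2]⟩, ?_⟩
      -- A detour through a point outside the interval would need an index that is both low and not
      -- low.
      rintro ⟨c, ⟨h1, h1'⟩ | ⟨h1, h1'⟩, ⟨h2, h2'⟩ | ⟨h2, h2'⟩⟩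
      · exact absurd (huniq c h1 h2.le) h2.ne
      · exact h2' c h2 le_rfl (h1' c h1 le_rfl)
      · exact h1' a h1 le_rfl (h2' a h1 hlt.le)
      · exact absurd (h2.trans h1) (not_lt.2 hlt.le)
    · refine Or.inr ⟨Or.inr ⟨hlt, fun c h1 h2 => by rwa [huniq c h1 h2]⟩, ?_⟩
      rintro ⟨c, ⟨h1, h1'⟩ | ⟨h1, h1'⟩, ⟨h2, h2'⟩ | ⟨h2, h2'⟩⟩
      · exact absurd (h1.trans h2) (not_lt.2 hlt.le)
      · exact h2' c h2 le_rfl (h1' c h1 le_rfl)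
      · exact h1' a (h2.trans_le le_rfl) hlt.le (h2' a h2 le_rfl)
      · exact absurd (huniq c h2 h1.le) h1.ne
  have bwd : ∀ a b : Fin n, (DiffEdge 𝓕 a b ∧ ¬ ∃ c, DiffEdge 𝓕 a c ∧ DiffEdge 𝓕 c b) →
      (b : ℕ) = a + 1 ∨ (a : ℕ) = b + 1 := by
    intro a b
    simp only [h𝓕.edge_iff]
    rintro ⟨⟨h1, h1'⟩ | ⟨h1, h1'⟩, hno⟩
    · left
      rw [Fin.lt_def] at h1
      by_contra hne
      have hc : (a : ℕ) + 1 < b := by omega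
      refine hno ⟨⟨a + 1, by omega⟩, Or.inl ⟨by simp [Fin.lt_def], fun d h2 h3 => ?_⟩,
        Or.inl ⟨hc, fun d h2 h3 => ?_⟩⟩
      · refine h1' d h2 (h3.trans ?_)
        exact hc.le
      · refine h1' d (lt_trans ?_ h2) h3
        simp [Fin.lt_def]
    · right
      rw [Fin.lt_def] at h1
      by_contra hne
      have hc : (b : ℕ) + 1 < a := by omega
      refine hno ⟨⟨b + 1, by omega⟩, Or.inr ⟨hc, fun d h2 h3 => ?_⟩,
        Or.inr ⟨by simp [Fin.lt_def], fun d h2 h3 => ?_⟩⟩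
      · refine h1' d (lt_trans ?_ h2) h3
        simp [Fin.lt_def]
      · refine h1' d h2 (h3.trans ?_)
        exact hc.le
  constructor
  · rintro (h | h)
    · exact fwd a b h
    · exact (fwd b a h).symm
  · rintro (h | h)
    · exact bwd a b h
    · exact (bwd b a h).symm

/-- A permutation that preserves adjacency is the identity or the reversal. -/
theorem Equiv.Perm.eq_refl_or_rev {π : Equiv.Perm (Fin n)}
    (h : ∀ a b : Fin n, (b : ℕ) = a + 1 → (π b : ℕ) = π a + 1 ∨ (π a : ℕ) = π b + 1) :
    (∀ k, π k = k) ∨ ∀ k, π k = k.rev := by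
  rcases Nat.lt_or_ge n 2 with hn | hn
  · left
    intro k
    apply Fin.ext
    have := (π k).2
    have := k.2
    omega
  rcases h ⟨0, by omega⟩ ⟨1, by omega⟩ rfl with h0 | h0
  · left
    -- The direction of the first step persists, since turning back would repeat a value. As n
    -- values must fit, the first one is then 0.
    have key : ∀ k, ∀ hk : k + 1 < n, (π ⟨k + 1, hk⟩ : ℕ) = π ⟨k, by omega⟩ + 1 := by
      intro k
      induction k with
      | zero => exact fun _ => h0
      | succ k ih =>
        intro hk
        rcases h ⟨k + 1, by omega⟩ ⟨k + 1 + 1, hk⟩ rfl with h1 | h1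
        · exact h1
        · have h2 := ih (by omega)
          have h3 : π ⟨k + 1 + 1, hk⟩ = π ⟨k, by omega⟩ := Fin.ext (by omega)
          have := π.injective h3
          simp at this
          omega
    have key2 : ∀ k, ∀ hk : k < n, (π ⟨k, hk⟩ : ℕ) = π ⟨0, by omega⟩ + k := by
      intro k
      induction k with
      | zero => intro _; rfl
      | succ k ih => intro hk; rw [key k hk, ih (by omega)]; rfl
    have h4 := key2 (n - 1) (by omega)
    have h5 := (π ⟨n - 1, by omega⟩).2
    rintro ⟨k, hk⟩
    apply Fin.ext
    rw [key2 k hk]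
    simp only
    omega
  · right
    have key : ∀ k, ∀ hk : k + 1 < n, (π ⟨k, by omega⟩ : ℕ) = π ⟨k + 1, hk⟩ + 1 := by
      intro k
      induction k with
      | zero => exact fun _ => h0
      | succ k ih =>
        intro hk
        rcases h ⟨k + 1, by omega⟩ ⟨k + 1 + 1, hk⟩ rfl with h1 | h1
        · have h2 := ih (by omega)
          have h3 : π ⟨k + 1 + 1, hk⟩ = π ⟨k, by omega⟩ := Fin.ext (by omega)
          have := π.injective h3
          simp at this
          omega
        · exact h1
    have key2 : ∀ k, ∀ hk : k < n, (π ⟨0, by omega⟩ : ℕ) = π ⟨k, hk⟩ + k := by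
      intro k
      induction k with
      | zero => intro _; rfl
      | succ k ih => intro hk; rw [ih (by omega), key k hk]; omega
    have h4 := key2 (n - 1) (by omega)
    have h5 := (π ⟨0, by omega⟩).2
    rintro ⟨k, hk⟩
    have h6 := key2 k hk
    apply Fin.ext
    rw [Fin.val_rev]
    simp only
    omega

/-! ### The isometries that realize the four cases. -/

theorem IsometricSets.trans {V : Type*} [NormedAddCommGroup V] [NormedSpace ℝ V] {P Q R : Set V}
    (h : IsometricSets P Q) (h' : IsometricSets Q R) : IsometricSets P R := by
  obtain ⟨g, rfl⟩ := h
  obtain ⟨g', rfl⟩ := h'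
  exact ⟨g.trans g', by rw [← Set.image_comp]; rfl⟩

theorem isometricSets_of_mem_iff {V : Type*} [NormedAddCommGroup V] [NormedSpace ℝ V]
    {P Q : Set V} (g : V ≃ᵢ V) (h : ∀ x, g x ∈ Q ↔ x ∈ P) : IsometricSets P Q := by
  refine ⟨g, Set.ext fun y => ⟨?_, fun hy => ?_⟩⟩
  · rintro ⟨x, hx, rfl⟩
    exact (h x).2 hx
  · refine ⟨g.symm y, (h _).1 ?_, g.apply_symm_apply y⟩
    rwa [g.apply_symm_apply]

/-- The point reflection x ↦ (n + 2, …, n + 2) - x is a symmetry of the permutahedron; on the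
hyperplane of the fixed coordinate sum it exchanges the inequalities of `S` and of its complement.
-/
theorem isometricSets_removahedron_compl :
    IsometricSets (removahedron 𝓕) (removahedron {S | Sᶜ ∈ 𝓕}) := by
  set p : EuclideanSpace ℝ (Fin (n + 1)) := WithLp.toLp 2 fun _ => (n : ℝ) + 2 with hp
  refine isometricSets_of_mem_iff (IsometryEquiv.subLeft p) fun x => ?_
  have hsum : ∀ S : Finset (Fin (n + 1)), ∑ c ∈ S, (IsometryEquiv.subLeft p x) c =
      S.card * ((n : ℝ) + 2) - ∑ c ∈ S, x c := fun S => by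
    simp [hp, mul_add]
  have hcompl : ∀ S : Finset (Fin (n + 1)), ((Sᶜ).card : ℝ) = n + 1 - S.card := fun S => by
    rw [Finset.card_compl, Nat.cast_sub (Finset.card_le_univ S)]
    simp
  have huniv : ∑ c, (IsometryEquiv.subLeft p x) c = ((n : ℝ) + 1) * ((n : ℝ) + 2) / 2 ↔
      ∑ c, x c = ((n : ℝ) + 1) * ((n : ℝ) + 2) / 2 := by
    rw [hsum]
    simp only [Finset.card_univ, Fintype.card_fin, Nat.cast_add, Nat.cast_one]
    constructor <;> intro h <;> linarith
  simp only [removahedron, Set.mem_ofPred_eq, huniv]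
  refine and_congr_left fun h => ?_
  have key : ∀ S : Finset (Fin (n + 1)), (((Sᶜ).card : ℝ) * (((Sᶜ).card : ℝ) + 1) / 2 ≤
      ∑ c ∈ Sᶜ, (IsometryEquiv.subLeft p x) c ↔
        (S.card : ℝ) * ((S.card : ℝ) + 1) / 2 ≤ ∑ c ∈ S, x c) := fun S => by
    have h1 := Finset.sum_add_sum_compl S fun c => x c
    rw [h] at h1
    rw [hsum, hcompl]
    constructor <;> intro h2 <;> nlinarith
  constructor
  · intro h2 S hS
    exact (key S).1 (h2 Sᶜ (by rwa [compl_compl]))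
  · intro h2 S hS
    have := (key Sᶜ).2 (h2 Sᶜ hS)
    rwa [compl_compl] at this

/-- The right-hand sides depend only on cardinalities, so reversing the coordinates merely reverses
the sets. -/
theorem isometricSets_removahedron_rev :
    IsometricSets (removahedron 𝓕)
      (removahedron {S | S.map Fin.revPerm.toEmbedding ∈ 𝓕}) := by
  refine isometricSets_of_mem_iff
    (LinearIsometryEquiv.piLpCongrLeft 2 ℝ ℝ Fin.revPerm).toIsometryEquiv fun x => ?_
  have key : ∀ S : Finset (Fin (n + 1)), ∑ c ∈ S, ((LinearIsometryEquiv.piLpCongrLeft 2 ℝ ℝ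
      Fin.revPerm).toIsometryEquiv x) c = ∑ c ∈ S.map Fin.revPerm.toEmbedding, x c := fun S => by
    rw [Finset.sum_map]
    refine Finset.sum_congr rfl fun c _ => ?_
    simp [LinearIsometryEquiv.piLpCongrLeft_apply, Equiv.piCongrLeft']
  have hmap : ∀ S : Finset (Fin (n + 1)),
      (S.map Fin.revPerm.toEmbedding).map Fin.revPerm.toEmbedding = S := fun S => by
    ext c; simp
  simp only [removahedron, Set.mem_ofPred_eq, key]
  refine and_congr ?_ (by rw [Finset.map_univ_equiv])
  constructor
  · intro h S hS
    have := h (S.map Fin.revPerm.toEmbedding) (by rwa [hmap])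
    rwa [hmap, Finset.card_map] at this
  · intro h S hS
    have := h _ hS
    rwa [Finset.card_map] at this

theorem IsAssociahedral.isometricSets (h𝓕 : IsAssociahedral 𝓕 low)
    (h𝓖 : IsAssociahedral 𝓖 low') (h : NormallyIsomorphic (removahedron 𝓕) (removahedron 𝓖)) :
    IsometricSets (removahedron 𝓕) (removahedron 𝓖) := by
  obtain ⟨ψ, hψ, hψ'⟩ := h.exists_mapsRays h𝓕.proper h𝓖.proper
  obtain ⟨π, ε, hε, h1, h2⟩ := h𝓕.exists_signed_perm h𝓖 hψ hψ'
  have hsingle : ∀ (T : Finset (Fin (n + 1))) (a b : Fin n),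
      (switchVector T = Pi.single (π b) 1 - Pi.single (π a) 1 ↔
        ∀ k, switchVector T (π k) = (Pi.single b 1 - Pi.single a 1 : Fin n → ℝ) k) := by
    intro T a b
    rw [funext_iff, ← π.forall_congr_right]
    simp [Pi.single_apply]
  have hedge : ∀ a b, DiffEdge 𝓖 (π a) (π b) ↔
      (ε = 1 ∧ DiffEdge 𝓕 a b) ∨ (ε = -1 ∧ DiffEdge 𝓕 b a) := by
    intro a b
    simp only [DiffEdge, hsingle]
    constructor
    · rintro ⟨T, hT, h3⟩
      obtain ⟨S, hS, h4⟩ := h2 T hT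
      rcases hε with rfl | rfl
      · refine Or.inl ⟨rfl, S, hS, funext fun k => ?_⟩
        rw [← h3, h4, one_mul]
      · refine Or.inr ⟨rfl, S, hS, funext fun k => ?_⟩
        have h5 := h3 k
        rw [h4] at h5
        simp only [Pi.sub_apply] at h5 ⊢
        linarith
    · rintro (⟨rfl, S, hS, h3⟩ | ⟨rfl, S, hS, h3⟩)
      · obtain ⟨T, hT, h4⟩ := h1 S hS
        exact ⟨T, hT, fun k => by rw [h4, h3, one_mul]⟩
      · obtain ⟨T, hT, h4⟩ := h1 S hS
        exact ⟨T, hT, fun k => by rw [h4, h3]; simp⟩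
  have hadj : ∀ a b : Fin n, (b : ℕ) = a + 1 →
      (π b : ℕ) = π a + 1 ∨ (π a : ℕ) = π b + 1 := by
    intro a b hab
    have h3 := (h𝓕.adjacent_iff a b).1 (Or.inl hab)
    rw [h𝓖.adjacent_iff]
    -- A sign -1 reverses all edges, but the criterion for adjacency is symmetric under this.
    simp only [← π.exists_congr_right (q := fun c => DiffEdge 𝓖 _ c ∧ DiffEdge 𝓖 c _), hedge]
    rcases hε with rfl | rfl
    · norm_num
      simpa using h3
    · norm_num
      rcases h3 with ⟨h3, h4⟩ | ⟨h3, h4⟩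
      · exact Or.inr ⟨h3, fun c h5 h6 => h4 ⟨c, h6, h5⟩⟩
      · exact Or.inl ⟨h3, fun c h5 h6 => h4 ⟨c, h6, h5⟩⟩
  -- Here `f` is the involution on subsets that induces the signed permutation on switch vectors.
  -- Reversal alone belongs to the sign -1, because it also exchanges entering and leaving the set.
  have main : ∀ f : Finset (Fin (n + 1)) → Finset (Fin (n + 1)),
      (∀ S T, (∀ k, switchVector T (π k) = ε * switchVector S k) →
        ∀ k, switchVector T k = switchVector (f S) k) →
      (∀ S, f (f S) = S) → 𝓖 = {S | f S ∈ 𝓕} := by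
    intro f hf hff
    ext T
    constructor
    · intro hT
      obtain ⟨S, hS, h3⟩ := h2 T hT
      have := switchVector_injective (h𝓖.proper T hT).1 (h𝓖.proper T hT).2 (hf S T h3)
      rw [this, Set.mem_ofPred_eq, hff]
      exact hS
    · intro hT
      obtain ⟨T', hT', h3⟩ := h1 _ hT
      have := switchVector_injective (h𝓖.proper T' hT').1 (h𝓖.proper T' hT').2 (hf _ T' h3)
      rw [hff] at this
      rwa [← this]
  have hmap : ∀ S : Finset (Fin (n + 1)),
      (S.map Fin.revPerm.toEmbedding).map Fin.revPerm.toEmbedding = S := fun S => by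
    ext c; simp
  rcases Equiv.Perm.eq_refl_or_rev hadj with hπ | hπ <;> simp only [hπ] at main <;>
    rcases hε with rfl | rfl
  · rw [main id (fun S T h3 k => by rw [h3, one_mul]; rfl) fun _ => rfl]
    exact ⟨IsometryEquiv.refl _, Set.image_id _⟩
  · rw [main compl (fun S T h3 k => by rw [h3, switchVector_compl, neg_one_mul]) compl_compl]
    exact isometricSets_removahedron_compl
  · rw [main (fun S => (S.map Fin.revPerm.toEmbedding)ᶜ) (fun S T h3 k => by
      have := h3 k.rev
      rw [Fin.rev_rev] at this
      rw [this, switchVector_compl, switchVector_map_rev, neg_neg, one_mul]) fun S => by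
        ext c; simp]
    exact isometricSets_removahedron_compl.trans isometricSets_removahedron_rev
  · rw [main (fun S => S.map Fin.revPerm.toEmbedding) (fun S T h3 k => by
      have := h3 k.rev
      rw [Fin.rev_rev] at this
      rw [this, switchVector_map_rev, neg_one_mul]) hmap]
    exact isometricSets_removahedron_rev

end

/-! ### The sets of a signed polygon, combinatorially. -/

/-- The nonempty proper subsets of `{1, …, n + 1}` that belong to pairs of vertices of the
polygon whose vertex `m` is positive if and only if `U m`. -/
def polygonSets (n : ℕ) (U : ℕ → Prop) : Set (Finset (Fin (n + 1))) :=
  {S | S ≠ ∅ ∧ S ≠ Finset.univ ∧ ∃ i j, i < j ∧ j ≤ n + 2 ∧ ∀ c : Fin (n + 1), c ∈ S ↔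
    ((c : ℕ) + 1 ≤ i ∧ U i) ∨ (i < (c : ℕ) + 1 ∧ (c : ℕ) + 1 < j ∧ ¬ U (c + 1)) ∨
      (j ≤ (c : ℕ) + 1 ∧ U j)}

/-- The default 0 is harmless as a left endpoint: no label 1, …, n + 1 is at most 0, so its sign is
never consulted. The default n + 2 on the right is equally harmless. -/
theorem exists_last_le (V : ℕ → Prop) (p : ℕ) :
    ∃ i ≤ p, (i = 0 ∨ V i) ∧ ∀ m, i < m → m ≤ p → ¬ V m := by
  induction p with
  | zero => exact ⟨0, le_rfl, Or.inl rfl, fun m h1 h2 => by omega⟩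
  | succ p ih =>
    by_cases h : V (p + 1)
    · exact ⟨p + 1, le_rfl, Or.inr h, fun m h1 h2 => by omega⟩
    · obtain ⟨i, hi, hi', hm⟩ := ih
      refine ⟨i, by omega, hi', fun m h1 h2 => ?_⟩
      rcases Nat.lt_or_ge p m with h3 | h3
      · rwa [show m = p + 1 by omega]
      · exact hm m h1 h3

theorem exists_first_gt (V : ℕ → Prop) {p N : ℕ} (hp : p < N) :
    ∃ j, p < j ∧ j ≤ N ∧ (j = N ∨ V j) ∧ ∀ m, p < m → m < j → ¬ V m := by
  obtain ⟨d, rfl⟩ : ∃ d, N = p + 1 + d := ⟨N - (p + 1), by omega⟩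
  clear hp
  induction d generalizing p with
  | zero => exact ⟨p + 1, by omega, le_rfl, Or.inl rfl, fun m h1 h2 => by omega⟩
  | succ d ih =>
    by_cases h : V (p + 1)
    · exact ⟨p + 1, by omega, by omega, Or.inr h, fun m h1 h2 => by omega⟩
    · obtain ⟨j, h1, h2, h3, h4⟩ := ih (p := p + 1)
      refine ⟨j, by omega, by omega, ?_, fun m h5 h6 => ?_⟩
      · rcases h3 with h3 | h3
        · left; omega
        · exact Or.inr h3
      · rcases Nat.lt_or_ge (p + 1) m with h7 | h7
        · exact h4 m h7 h6
        · rwa [show m = p + 1 by omega]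

section

variable {n : ℕ} {U : ℕ → Prop}

theorem Iic_mem_polygonSets (hn1 : ¬ U (n + 1)) (k : Fin n) :
    Finset.Iic k.castSucc ∈ polygonSets n U := by
  have hk := k.2
  refine ⟨?_, ?_, ?_⟩
  · exact Finset.nonempty_iff_ne_empty.1 ⟨_, Finset.mem_Iic.2 le_rfl⟩
  · intro h
    have := Finset.eq_univ_iff_forall.1 h (Fin.last n)
    simp only [Finset.mem_Iic, Fin.le_def, Fin.val_last, Fin.val_castSucc] at this
    omega
  -- The chord runs from the last positive vertex up to k + 1 to the first negative vertex after it;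
  -- the latter exists because n + 1 is negative.
  obtain ⟨i, hi, hi', him⟩ := exists_last_le U (k + 1)
  obtain ⟨j, hj, hjN, hj', hjm⟩ := exists_first_gt (fun m => ¬ U m) (p := k + 1) (N := n + 1)
    (by omega)
  have hUj : ¬ U j := by rcases hj' with rfl | hj' <;> assumption
  refine ⟨i, j, by omega, by omega, fun c => ?_⟩
  have h1 := him (c + 1)
  have h2 := hjm (c + 1)
  simp only [Finset.mem_Iic, Fin.le_def, Fin.val_castSucc]
  constructor
  · intro h
    rcases Nat.lt_or_ge i (c + 1) with h3 | h3
    · exact Or.inr (Or.inl ⟨h3, by omega, h1 h3 (by omega)⟩)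
    · exact Or.inl ⟨h3, hi'.resolve_left (by omega)⟩
  · rintro (⟨h3, _⟩ | ⟨h3, h4, h5⟩ | ⟨_, h3⟩)
    · omega
    · by_contra h6
      exact h2 (by omega) h4 h5
    · exact absurd h3 hUj

theorem compl_Iic_mem_polygonSets (h1 : ¬ U 1) (k : Fin n) :
    (Finset.Iic k.castSucc)ᶜ ∈ polygonSets n U := by
  have hk := k.2
  refine ⟨?_, ?_, ?_⟩
  · intro h
    have := Finset.eq_empty_iff_forall_notMem.1 h (Fin.last n)
    simp only [Finset.mem_compl, Finset.mem_Iic, Fin.le_def, Fin.val_last, Fin.val_castSucc] at this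
    omega
  · intro h
    have := Finset.eq_univ_iff_forall.1 h k.castSucc
    simp at this
  -- The signs are exchanged here; a negative left endpoint exists because vertex 1 is negative.
  obtain ⟨i, hi, hi', him⟩ := exists_last_le (fun m => ¬ U m) (k + 1)
  obtain ⟨j, hj, hjN, hj', hjm⟩ := exists_first_gt U (p := k + 1) (N := n + 2) (by omega)
  have hi0 : 0 < i := Nat.pos_of_ne_zero fun h0 => him 1 (by omega) (by omega) h1
  have hUi : ¬ U i := hi'.resolve_left hi0.ne'
  refine ⟨i, j, by omega, hjN, fun c => ?_⟩
  have hc := c.2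
  have h1 := him (c + 1)
  have h2 := hjm (c + 1)
  simp only [Finset.mem_compl, Finset.mem_Iic, Fin.le_def, Fin.val_castSucc, not_le]
  constructor
  · intro h
    rcases Nat.lt_or_ge (c + 1) j with h3 | h3
    · exact Or.inr (Or.inl ⟨by omega, h3, h2 (by omega) h3⟩)
    · exact Or.inr (Or.inr ⟨h3, hj'.resolve_left (by omega)⟩)
  · rintro (⟨_, h3⟩ | ⟨h3, h4, h5⟩ | ⟨h3, _⟩)
    · exact absurd h3 hUi
    · by_contra h6
      exact h1 h3 (by omega) h5
    · omega

theorem eq_Iic_of_mem_polygonSets {S : Finset (Fin (n + 1))} (hS : S ∈ polygonSets n U)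
    (hS' : Sᶜ ∈ polygonSets n U) :
    ∃ k : Fin n, S = Finset.Iic k.castSucc ∨ Sᶜ = Finset.Iic k.castSucc := by
  obtain ⟨h0, h1, i, j, hij, hj, hm⟩ := hS
  obtain ⟨-, -, i', j', hij', hj', hm'⟩ := hS'
  simp only [Finset.mem_compl] at hm'
  have hl : ∀ c : Fin (n + 1), (c : ℕ) + 1 ≤ i → (c ∈ S ↔ U i) := fun c hc => by
    rw [hm]
    constructor
    · rintro (h | h | h)
      · exact h.2
      · omega
      · omega
    · exact fun h => Or.inl ⟨hc, h⟩
  have hr : ∀ c : Fin (n + 1), j ≤ (c : ℕ) + 1 → (c ∈ S ↔ U j) := fun c hc => by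
    rw [hm]
    constructor
    · rintro (h | h | h)
      · omega
      · omega
      · exact h.2
    · exact fun h => Or.inr (Or.inr ⟨hc, h⟩)
  have hl' : ∀ c : Fin (n + 1), (c : ℕ) + 1 ≤ i' → (c ∈ S ↔ ¬ U i') := fun c hc => by
    rw [← not_iff_not, not_not, hm']
    constructor
    · rintro (h | h | h)
      · exact h.2
      · omega
      · omega
    · exact fun h => Or.inl ⟨hc, h⟩
  have hr' : ∀ c : Fin (n + 1), j' ≤ (c : ℕ) + 1 → (c ∈ S ↔ ¬ U j') := fun c hc => by
    rw [← not_iff_not, not_not, hm']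
    constructor
    · rintro (h | h | h)
      · omega
      · omega
      · exact h.2
    · exact fun h => Or.inr (Or.inr ⟨hc, h⟩)
  -- A label strictly inside both chords would lie in `S` and in its complement under the same
  -- condition. So `S` is constant up to max i i' and constant afterwards.
  have hmid : min j j' ≤ max i i' + 1 := by
    by_contra hlt
    have h2 : (⟨max i i', by omega⟩ : Fin (n + 1)) ∈ S ↔ ¬ U (max i i' + 1) := by
      rw [hm]
      constructor
      · rintro (h | h | h)
        · have := h.1; simp only at this; omega
        · exact h.2.2
        · have := h.1; simp only at this; omega
      · exact fun h => Or.inr (Or.inl ⟨by simp only; omega, by simp only; omega, h⟩)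
    have h3 : (⟨max i i', by omega⟩ : Fin (n + 1)) ∉ S ↔ ¬ U (max i i' + 1) := by
      rw [hm']
      constructor
      · rintro (h | h | h)
        · have := h.1; simp only at this; omega
        · exact h.2.2
        · have := h.1; simp only at this; omega
      · exact fun h => Or.inr (Or.inl ⟨by simp only; omega, by simp only; omega, h⟩)
    tauto
  obtain ⟨p, A, B, hA, hB⟩ : ∃ (p : ℕ) (A B : Prop),
      (∀ c : Fin (n + 1), (c : ℕ) + 1 ≤ p → (c ∈ S ↔ A)) ∧
        ∀ c : Fin (n + 1), p + 1 ≤ (c : ℕ) + 1 → (c ∈ S ↔ B) := by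
    rcases le_total i i' with h | h
    · rcases le_or_gt j (i' + 1) with h' | h'
      · exact ⟨i', _, _, hl', fun c hc => hr c (h'.trans hc)⟩
      · exact ⟨i', _, _, hl', fun c hc => hr' c (by omega)⟩
    · rcases le_or_gt j (i + 1) with h' | h'
      · exact ⟨i, _, _, hl, fun c hc => hr c (h'.trans hc)⟩
      · exact ⟨i, _, _, hl, fun c hc => hr' c (by omega)⟩
  obtain ⟨a, ha⟩ := Finset.nonempty_iff_ne_empty.2 h0
  obtain ⟨b, hb⟩ := not_forall.1 fun h => h1 (Finset.eq_univ_iff_forall.2 h)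
  have ha2 := a.2
  have hb2 := b.2
  have hp : 1 ≤ p ∧ p ≤ n := by
    constructor
    · by_contra hp
      exact hb ((hB b (by omega)).2 ((hB a (by omega)).1 ha))
    · by_contra hp
      exact hb ((hA b (by omega)).2 ((hA a (by omega)).1 ha))
  refine ⟨⟨p - 1, by omega⟩, ?_⟩
  by_cases hAt : A
  · left
    have hBf : ¬ B := fun hBt => hb <| by
      rcases le_or_gt ((b : ℕ) + 1) p with h | h
      · exact (hA b h).2 hAt
      · exact (hB b h).2 hBt
    ext c
    simp only [Finset.mem_Iic, Fin.le_def, Fin.val_castSucc]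
    rcases le_or_gt ((c : ℕ) + 1) p with h | h
    · exact iff_of_true ((hA c h).2 hAt) (by omega)
    · exact iff_of_false (fun h' => hBf ((hB c h).1 h')) (by omega)
  · right
    have hBt : B := by
      rcases le_or_gt ((a : ℕ) + 1) p with h | h
      · exact absurd ((hA a h).1 ha) hAt
      · exact (hB a h).1 ha
    ext c
    simp only [Finset.mem_compl, Finset.mem_Iic, Fin.le_def, Fin.val_castSucc]
    rcases le_or_gt ((c : ℕ) + 1) p with h | h
    · exact iff_of_true (fun h' => hAt ((hA c h).1 h')) (by omega)
    · exact iff_of_false (not_not.2 ((hB c h).2 hBt)) (by omega)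

/-- Between two switches of a member of `polygonSets n U`, the members are the negative
vertices. -/
theorem mem_iff_of_switchVector_ne_zero {S : Finset (Fin (n + 1))} (hS : S ∈ polygonSets n U)
    {a b : Fin n} (ha : switchVector S a ≠ 0) (hb : switchVector S b ≠ 0) (c : Fin (n + 1))
    (hac : (a : ℕ) < c) (hcb : (c : ℕ) ≤ b) : c ∈ S ↔ ¬ U (c + 1) := by
  obtain ⟨-, -, i, j, hij, hj, hm⟩ := hS
  rw [Ne, switchVector_eq_zero_iff] at ha hb
  have hi : i ≤ a + 1 := by
    by_contra hi
    refine ha ?_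
    rw [hm, hm]
    simp only [Fin.val_castSucc, Fin.val_succ]
    constructor
    · rintro (h | h | h)
      · exact Or.inl ⟨by omega, h.2⟩
      · omega
      · omega
    · rintro (h | h | h)
      · exact Or.inl ⟨by omega, h.2⟩
      · omega
      · omega
  have hj : b + 2 ≤ j := by
    by_contra hj
    refine hb ?_
    rw [hm, hm]
    simp only [Fin.val_castSucc, Fin.val_succ]
    constructor
    · rintro (h | h | h)
      · omega
      · omega
      · exact Or.inr (Or.inr ⟨by omega, h.2⟩)
    · rintro (h | h | h)
      · omega
      · omega
      · exact Or.inr (Or.inr ⟨by omega, h.2⟩)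
  rw [hm]
  constructor
  · rintro (h | h | h)
    · omega
    · exact h.2.2
    · omega
  · exact fun h => Or.inr (Or.inl ⟨by omega, by omega, h⟩)

theorem mem_iff_of_switchVector_eq_zero {S : Finset (Fin (n + 1))} {a b : Fin n}
    (h : ∀ k, a < k → k < b → switchVector S k = 0) (c : Fin n) (hac : a < c) (hcb : c ≤ b) :
    c.castSucc ∈ S ↔ a.succ ∈ S := by
  obtain ⟨c, hc⟩ := c
  obtain ⟨a, ha⟩ := a
  simp only [Fin.lt_def, Fin.le_def] at h hac hcb
  induction c, hac using Nat.le_induction with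
  | base => rfl
  | succ c hac ih =>
    have h1 := h ⟨c, by omega⟩ hac (Nat.lt_of_succ_le hcb)
    rw [switchVector_eq_zero_iff] at h1
    rw [← ih (by omega) (Nat.le_of_succ_le hcb), h1]
    rfl

/-- Between the two switches the set consists of the negative vertices, and it is constant there; so
these vertices have one sign, which the sign of the first switch determines. -/
theorem diffEdge_polygonSets_iff (a b : Fin n) : DiffEdge (polygonSets n U) a b ↔
    (a < b ∧ ∀ c : Fin n, a < c → c ≤ b → ¬ U (c + 1)) ∨
      (b < a ∧ ∀ c : Fin n, b < c → c ≤ a → ¬ ¬ U (c + 1)) := by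
  have hproper : ProperSubsets (polygonSets n U) := fun S hS => ⟨hS.1, hS.2.1⟩
  constructor
  · intro h
    have hne := h.ne hproper
    obtain ⟨S, hS, h⟩ := h
    have ha : switchVector S a = -1 := by rw [h]; simp [Pi.single_eq_of_ne hne]
    have hb : switchVector S b = 1 := by rw [h]; simp [Pi.single_eq_of_ne hne.symm]
    have h0 : ∀ k, k ≠ a → k ≠ b → switchVector S k = 0 := fun k hka hkb => by
      rw [h, Pi.sub_apply, Pi.single_eq_of_ne hka, Pi.single_eq_of_ne hkb, sub_zero]
    rcases lt_or_gt_of_ne hne with hlt | hlt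
    · refine Or.inl ⟨hlt, fun c h1 h2 => ?_⟩
      have h3 := mem_iff_of_switchVector_ne_zero hS (a := a) (b := b) (by rw [ha]; norm_num)
        (by rw [hb]; norm_num) c.castSucc h1 h2
      rw [mem_iff_of_switchVector_eq_zero (fun k hk hk' => h0 k hk.ne' hk'.ne) c h1 h2] at h3
      refine h3.1 ?_
      by_contra h4
      simp only [switchVector, h4, if_false] at ha
      split_ifs at ha <;> norm_num at ha
    · refine Or.inr ⟨hlt, fun c h1 h2 => ?_⟩
      have h3 := mem_iff_of_switchVector_ne_zero hS (a := b) (b := a) (by rw [hb]; norm_num)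
        (by rw [ha]; norm_num) c.castSucc h1 h2
      rw [mem_iff_of_switchVector_eq_zero (fun k hk hk' => h0 k hk'.ne hk.ne') c h1 h2] at h3
      refine fun h5 => ?_
      have h4 := h3.2 h5
      simp only [switchVector, h4, if_true] at hb
      split_ifs at hb <;> norm_num at hb
  · rintro (⟨hlt, h⟩ | ⟨hlt, h⟩)
    · have hbn := b.2
      rw [Fin.lt_def] at hlt
      -- The chord joins the nearest negative vertices around the block; these contribute nothing
      -- outside, and the vertices skipped are positive. The other case is dual.
      obtain ⟨i, hi, hi', him⟩ := exists_last_le (fun m => ¬ U m) (a + 1)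
      obtain ⟨j, hj, hjN, hj', hjm⟩ := exists_first_gt (fun m => ¬ U m) (p := b + 1) (N := n + 2)
        (by omega)
      refine ⟨Finset.Ioc a.castSucc b.castSucc, ⟨?_, ?_, i, j, by omega, hjN, fun c => ?_⟩, ?_⟩
      · exact Finset.nonempty_iff_ne_empty.1 ⟨b.castSucc, by simp [Fin.lt_def, hlt]⟩
      · intro h
        have := Finset.eq_univ_iff_forall.1 h a.castSucc
        simp at this
      · have hc := c.2
        have h1 := him (c + 1)
        have h2 := hjm (c + 1)
        simp only [Finset.mem_Ioc, Fin.lt_def, Fin.le_def, Fin.val_castSucc]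
        constructor
        · intro h3
          exact Or.inr (Or.inl ⟨by omega, by omega, h ⟨c, by omega⟩ h3.1 h3.2⟩)
        · rintro (⟨h3, h4⟩ | ⟨h3, h4, h5⟩ | ⟨h3, h4⟩)
          · exact absurd h4 (hi'.resolve_left (by omega))
          · by_contra h6
            rcases le_or_gt ((c : ℕ) + 1) (a + 1) with h7 | h7
            · exact h1 h3 h7 h5
            · exact h2 (by omega) h4 h5
          · exact absurd h4 (hj'.resolve_left (by omega))
      · ext m
        simp only [switchVector, Finset.mem_Ioc, Fin.lt_def, Fin.le_def, Fin.val_castSucc,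
          Fin.val_succ, Pi.sub_apply, Pi.single_apply, Fin.ext_iff]
        split_ifs <;> first | omega | norm_num
    · have hbn := a.2
      rw [Fin.lt_def] at hlt
      obtain ⟨i, hi, hi', him⟩ := exists_last_le U (b + 1)
      obtain ⟨j, hj, hjN, hj', hjm⟩ := exists_first_gt U (p := a + 1) (N := n + 2) (by omega)
      refine ⟨(Finset.Ioc b.castSucc a.castSucc)ᶜ, ⟨?_, ?_, i, j, by omega, hjN, fun c => ?_⟩, ?_⟩
      · exact Finset.nonempty_iff_ne_empty.1 ⟨b.castSucc, by simp⟩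
      · intro h
        have := Finset.eq_univ_iff_forall.1 h a.castSucc
        simp only [Finset.mem_compl, Finset.mem_Ioc, Fin.lt_def, Fin.le_def, Fin.val_castSucc] at this
        omega
      · have hc := c.2
        have h1 := him (c + 1)
        have h2 := hjm (c + 1)
        simp only [Finset.mem_compl, Finset.mem_Ioc, Fin.lt_def, Fin.le_def, Fin.val_castSucc]
        constructor
        · intro h3
          rcases le_or_gt ((c : ℕ) + 1) i with h4 | h4
          · exact Or.inl ⟨h4, hi'.resolve_left (by omega)⟩
          rcases le_or_gt j ((c : ℕ) + 1) with h5 | h5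
          · exact Or.inr (Or.inr ⟨h5, hj'.resolve_left (by omega)⟩)
          refine Or.inr (Or.inl ⟨h4, h5, ?_⟩)
          rcases le_or_gt ((c : ℕ) + 1) (b + 1) with h7 | h7
          · exact h1 h4 h7
          · exact h2 (by omega) h5
        · rintro (⟨h3, h4⟩ | ⟨h3, h4, h5⟩ | ⟨h3, h4⟩) h6
          · omega
          · exact h ⟨c, by omega⟩ h6.1 h6.2 h5
          · omega
      · ext m
        simp only [switchVector, Finset.mem_compl, Finset.mem_Ioc, Fin.lt_def, Fin.le_def,
          Fin.val_castSucc, Fin.val_succ, Pi.sub_apply, Pi.single_apply, Fin.ext_iff]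
        split_ifs <;> first | omega | norm_num

theorem isAssociahedral_polygonSets (h1 : ¬ U 1) (hn1 : ¬ U (n + 1)) :
    IsAssociahedral (polygonSets n U) fun c => ¬ U (c + 1) where
  proper := fun _ hS => ⟨hS.1, hS.2.1⟩
  Iic_mem := Iic_mem_polygonSets hn1
  compl_Iic_mem := compl_Iic_mem_polygonSets h1
  eq_Iic := fun _ hS hS' => eq_Iic_of_mem_polygonSets hS hS'
  edge_iff := diffEdge_polygonSets_iff

end

/-! ### From the geometry of the polygon to the combinatorial sets. -/

namespace HohlwegLange

variable {n : ℕ} (σ : Fin (n - 1) → ℤˣ)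

/-- On the parabola that carries the positive vertices, a point lies above the chord of two
points on both sides of it. -/
theorem parabola_chord_lt {N x y z : ℤ} (hxy : x < y) (hyz : y < z) :
    (z - y) * ((x + 1) * (N - x)) + (y - x) * ((z + 1) * (N - z)) <
      (z - x) * ((y + 1) * (N - y)) := by
  have h : 0 < (z - x) * (y - x) * (z - y) :=
    mul_pos (mul_pos (by linarith) (by linarith)) (by linarith)
  linear_combination h

theorem abs_vertexY_le (k : Fin (n + 3)) :
    |vertexY σ k| = (vertexX k + 1) * ((n : ℤ) + 3 - vertexX k) := by
  have h0 : 0 ≤ (vertexX k + 1) * ((n : ℤ) + 3 - vertexX k) := by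
    have := k.2
    unfold vertexX
    exact mul_nonneg (by omega) (by omega)
  rcases Int.units_eq_one_or (extSign σ k) with h | h <;> simp [vertexY, h, abs_of_nonneg h0]

/-- Every vertex lies on or below the upper parabola, so the chord lies below the parabola at `j`,
whatever the signs of `i` and `k`. -/
theorem chord_lt_of_extSign_eq_one {i j k : Fin (n + 3)} (hij : i < j) (hjk : j < k)
    (h : extSign σ j = 1) :
    (vertexX k - vertexX j) * vertexY σ i + (vertexX j - vertexX i) * vertexY σ k <
      (vertexX k - vertexX i) * vertexY σ j := by
  have h1 : vertexX i < vertexX j := by unfold vertexX; rw [Fin.lt_def] at hij; omega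
  have h2 : vertexX j < vertexX k := by unfold vertexX; rw [Fin.lt_def] at hjk; omega
  have hi := (le_abs_self _).trans (abs_vertexY_le σ i).le
  have hk := (le_abs_self _).trans (abs_vertexY_le σ k).le
  have hj : vertexY σ j = (vertexX j + 1) * ((n : ℤ) + 3 - vertexX j) := by simp [vertexY, h]
  rw [hj]
  refine lt_of_le_of_lt (add_le_add (mul_le_mul_of_nonneg_left hi (by linarith))
    (mul_le_mul_of_nonneg_left hk (by linarith))) (parabola_chord_lt h1 h2)

theorem lt_chord_of_extSign_ne_one {i j k : Fin (n + 3)} (hij : i < j) (hjk : j < k)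
    (h : extSign σ j ≠ 1) :
    (vertexX k - vertexX i) * vertexY σ j <
      (vertexX k - vertexX j) * vertexY σ i + (vertexX j - vertexX i) * vertexY σ k := by
  have h1 : vertexX i < vertexX j := by unfold vertexX; rw [Fin.lt_def] at hij; omega
  have h2 : vertexX j < vertexX k := by unfold vertexX; rw [Fin.lt_def] at hjk; omega
  have hi := (neg_abs_le (vertexY σ i)).trans' (neg_le_neg (abs_vertexY_le σ i).le)
  have hk := (neg_abs_le (vertexY σ k)).trans' (neg_le_neg (abs_vertexY_le σ k).le)
  have hj : vertexY σ j = -((vertexX j + 1) * ((n : ℤ) + 3 - vertexX j)) := by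
    simp [vertexY, (Int.units_eq_one_or (extSign σ j)).resolve_left h]
  rw [hj]
  have h3 := add_le_add (mul_le_mul_of_nonneg_left hi (sub_nonneg.2 h2.le))
    (mul_le_mul_of_nonneg_left hk (sub_nonneg.2 h1.le))
  have h4 := parabola_chord_lt (N := (n : ℤ) + 3) h1 h2
  linarith

/-- Among three vertices, only the sign of the middle one decides how they are oriented. -/
theorem isBelow_iff {i j : Fin (n + 3)} (hij : i < j) (k : Fin (n + 3)) : IsBelow σ i j k ↔
    (k < i ∧ extSign σ i = 1) ∨ (i < k ∧ k < j ∧ extSign σ k ≠ 1) ∨ (j < k ∧ extSign σ j = 1) := by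
  unfold IsBelow
  rcases lt_trichotomy k i with hk | rfl | hk
  · have e1 := hk.not_gt
    have e2 := (hk.trans hij).not_gt
    by_cases h : extSign σ i = 1
    · have := chord_lt_of_extSign_eq_one σ hk hij h
      simp only [hk, h, true_and, true_or, iff_true]
      linarith
    · have := lt_chord_of_extSign_ne_one σ hk hij h
      simp only [h, e1, e2, and_false, false_and, or_self, iff_false, not_lt]
      linarith
  · simp [hij.not_gt]
  rcases lt_trichotomy k j with hkj | rfl | hkj
  · have e1 := hk.not_gt
    have e2 := hkj.not_gt
    by_cases h : extSign σ k = 1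
    · have := chord_lt_of_extSign_eq_one σ hk hkj h
      simp only [h, e1, e2, ne_eq, not_true, and_false, false_and, or_self, iff_false, not_lt]
      linarith
    · have := lt_chord_of_extSign_ne_one σ hk hkj h
      simp only [hk, hkj, h, ne_eq, not_false_eq_true, and_self, true_or, or_true, iff_true]
      linarith
  · simp only [hij.not_gt, lt_irrefl, false_and, and_false, or_self, iff_false, not_lt]
    linarith
  · have e1 := hk.not_gt
    have e2 := hkj.not_gt
    by_cases h : extSign σ j = 1
    · have := chord_lt_of_extSign_eq_one σ hij hkj h
      simp only [hkj, h, true_and, or_true, iff_true]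
      linarith
    · have := lt_chord_of_extSign_ne_one σ hij hkj h
      simp only [h, e1, e2, and_false, false_and, or_self, iff_false, not_lt]
      linarith

theorem isAbove_iff {i j : Fin (n + 3)} (hij : i < j) (k : Fin (n + 3)) : IsAbove σ i j k ↔
    (k < i ∧ extSign σ i ≠ 1) ∨ (i < k ∧ k < j ∧ extSign σ k = 1) ∨ (j < k ∧ extSign σ j ≠ 1) := by
  unfold IsAbove
  rcases lt_trichotomy k i with hk | rfl | hk
  · have e1 := hk.not_gt
    have e2 := (hk.trans hij).not_gt
    by_cases h : extSign σ i = 1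
    · have := chord_lt_of_extSign_eq_one σ hk hij h
      simp only [h, e1, e2, ne_eq, not_true, and_false, false_and, or_self, iff_false, not_lt]
      linarith
    · have := lt_chord_of_extSign_ne_one σ hk hij h
      simp only [hk, h, ne_eq, not_false_eq_true, and_self, true_or, iff_true]
      linarith
  · simp [hij.not_gt]
  rcases lt_trichotomy k j with hkj | rfl | hkj
  · have e1 := hk.not_gt
    have e2 := hkj.not_gt
    by_cases h : extSign σ k = 1
    · have := chord_lt_of_extSign_eq_one σ hk hkj h
      simp only [hk, hkj, h, and_self, true_or, or_true, iff_true]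
      linarith
    · have := lt_chord_of_extSign_ne_one σ hk hkj h
      simp only [h, e1, e2, and_false, false_and, or_self, iff_false, not_lt]
      linarith
  · simp only [hij.not_gt, lt_irrefl, false_and, and_false, or_self, iff_false, not_lt]
    linarith
  · have e1 := hk.not_gt
    have e2 := hkj.not_gt
    by_cases h : extSign σ j = 1
    · have := chord_lt_of_extSign_eq_one σ hij hkj h
      simp only [h, e1, e2, ne_eq, not_true, and_false, false_and, or_self, iff_false, not_lt]
      linarith
    · have := lt_chord_of_extSign_ne_one σ hij hkj h
      simp only [hkj, h, ne_eq, not_false_eq_true, and_self, or_true, iff_true]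
      linarith

/-- Vertex 0 is below the chord exactly when 0 < i and `i` is positive, so replacing it by `i` turns
the strict inequality at `i` into a weak one; likewise at `j`. -/
theorem mem_normalSet_iff {i j : Fin (n + 3)} (hij : i < j) (c : Fin (n + 1)) :
    c ∈ normalSet σ i j ↔ (c.succ.castSucc ≤ i ∧ extSign σ i = 1) ∨
      (i < c.succ.castSucc ∧ c.succ.castSucc < j ∧ extSign σ c.succ.castSucc ≠ 1) ∨
        (j ≤ c.succ.castSucc ∧ extSign σ j = 1) := by
  have hm0 : c.succ.castSucc ≠ 0 := Fin.ne_of_gt (Nat.succ_pos c)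
  have hml : c.succ.castSucc ≠ Fin.last (n + 2) :=
    Fin.ne_of_lt (Nat.succ_lt_succ c.2)
  simp only [normalSet, belowSet, Finset.mem_filter, Finset.mem_univ, true_and, Finset.mem_image]
  generalize c.succ.castSucc = m at *
  constructor
  · rintro ⟨k, hk, h⟩
    rw [isBelow_iff σ hij] at hk
    split_ifs at h with h1 h2
    · subst h h1
      rcases hk with hk | hk | hk
      · exact Or.inl ⟨le_rfl, hk.2⟩
      · exact absurd hk.1 (Fin.not_lt_zero _)
      · exact absurd hk.1 (Fin.not_lt_zero _)
    · subst h h2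
      rcases hk with hk | hk | hk
      · exact absurd hk.1 (Fin.le_last _).not_gt
      · exact absurd hk.2.1 (Fin.le_last _).not_gt
      · exact Or.inr (Or.inr ⟨le_rfl, hk.2⟩)
    · subst h
      exact hk.imp (And.imp_left le_of_lt) (Or.imp_right (And.imp_left le_of_lt))
  · intro h
    rcases h with ⟨h, hs⟩ | h | ⟨h, hs⟩
    · rcases h.lt_or_eq with h' | rfl
      · exact ⟨m, (isBelow_iff σ hij m).2 (Or.inl ⟨h', hs⟩), by rw [if_neg hm0, if_neg hml]⟩
      · exact ⟨0, (isBelow_iff σ hij 0).2 (Or.inl ⟨Fin.pos_of_ne_zero hm0, hs⟩), if_pos rfl⟩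
    · exact ⟨m, (isBelow_iff σ hij m).2 (Or.inr (Or.inl h)), by rw [if_neg hm0, if_neg hml]⟩
    · rcases h.lt_or_eq with h' | rfl
      · exact ⟨m, (isBelow_iff σ hij m).2 (Or.inr (Or.inr ⟨h', hs⟩)),
          by rw [if_neg hm0, if_neg hml]⟩
      · refine ⟨Fin.last _, (isBelow_iff σ hij _).2
          (Or.inr (Or.inr ⟨Fin.lt_last_iff_ne_last.2 hml, hs⟩)), ?_⟩
        rw [if_neg (by simp [Fin.ext_iff]), if_pos rfl]

theorem isDiagonal_of_normalSet_ne {i j : Fin (n + 3)} (hij : i < j) (h0 : normalSet σ i j ≠ ∅)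
    (h1 : normalSet σ i j ≠ Finset.univ) : IsDiagonal σ i j := by
  refine ⟨hij, ?_, ?_⟩
  · obtain ⟨c, hc⟩ := Finset.nonempty_iff_ne_empty.2 h0
    simp only [normalSet, belowSet, Finset.mem_filter, Finset.mem_univ, true_and,
      Finset.mem_image] at hc
    obtain ⟨k, hk, -⟩ := hc
    exact ⟨k, hk⟩
  · obtain ⟨c, hc⟩ := not_forall.1 fun h => h1 (Finset.eq_univ_iff_forall.2 h)
    rw [mem_normalSet_iff σ hij] at hc
    have hm0 : c.succ.castSucc ≠ 0 := Fin.ne_of_gt (Nat.succ_pos c)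
    have hml : c.succ.castSucc ≠ Fin.last (n + 2) :=
      Fin.ne_of_lt (Nat.succ_lt_succ c.2)
    generalize c.succ.castSucc = m at *
    push Not at hc
    obtain ⟨h2, h3, h4⟩ := hc
    rcases le_or_gt m i with h | h
    · exact ⟨0, (isAbove_iff σ hij 0).2
        (Or.inl ⟨(Fin.pos_of_ne_zero hm0).trans_le h, h2 h⟩)⟩
    rcases le_or_gt j m with h' | h'
    · exact ⟨Fin.last _, (isAbove_iff σ hij _).2
        (Or.inr (Or.inr ⟨h'.trans_lt (Fin.lt_last_iff_ne_last.2 hml), h4 h'⟩))⟩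
    · exact ⟨m, (isAbove_iff σ hij m).2 (Or.inr (Or.inl ⟨h, h', h3 h h'⟩))⟩

/-- The vertex `m` of the polygon exists and is positive. -/
def IsPositive (m : ℕ) : Prop :=
  ∃ h : m < n + 3, extSign σ ⟨m, h⟩ = 1

theorem isPositive_coe (k : Fin (n + 3)) : IsPositive σ k ↔ extSign σ k = 1 :=
  ⟨fun ⟨_, h⟩ => h, fun h => ⟨k.2, h⟩⟩

theorem mem_polygonSets_iff {S : Finset (Fin (n + 1))} :
    S ∈ polygonSets n (IsPositive σ) ↔
      S ≠ ∅ ∧ S ≠ Finset.univ ∧ ∃ i j, i < j ∧ S = normalSet σ i j := by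
  have key : ∀ i j : Fin (n + 3), i < j → ∀ c : Fin (n + 1), c ∈ normalSet σ i j ↔
      ((c : ℕ) + 1 ≤ i ∧ IsPositive σ i) ∨
      ((i : ℕ) < (c : ℕ) + 1 ∧ (c : ℕ) + 1 < j ∧ ¬ IsPositive σ (c + 1)) ∨
      ((j : ℕ) ≤ (c : ℕ) + 1 ∧ IsPositive σ j) := by
    intro i j hij c
    have h := isPositive_coe σ c.succ.castSucc
    simp only [Fin.val_castSucc, Fin.val_succ] at h
    rw [mem_normalSet_iff σ hij, isPositive_coe, isPositive_coe, h]
    simp only [Fin.le_def, Fin.lt_def, Fin.val_castSucc, Fin.val_succ, ne_eq]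
  refine and_congr_right fun _ => and_congr_right fun _ => ⟨?_, ?_⟩
  · rintro ⟨i, j, hij, hj, h⟩
    refine ⟨⟨i, by omega⟩, ⟨j, by omega⟩, hij, Finset.ext fun c => ?_⟩
    rw [key _ _ hij]
    exact h c
  · rintro ⟨i, j, hij, rfl⟩
    exact ⟨i, j, hij, by omega, key i j hij⟩

/-- Pairs with a nonempty proper set are diagonals, and the empty and full sets give inequalities
that hold trivially on the hyperplane. -/
theorem associahedron_eq_removahedron :
    associahedron σ = removahedron (polygonSets n (IsPositive σ)) := by
  ext x
  refine and_congr_left fun hx => ⟨fun h S hS => ?_, fun h i j hij => ?_⟩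
  · obtain ⟨h0, h1, i, j, hij, rfl⟩ := (mem_polygonSets_iff σ).1 hS
    exact h i j (isDiagonal_of_normalSet_ne σ hij h0 h1)
  · by_cases h0 : normalSet σ i j = ∅
    · simp [h0]
    by_cases h1 : normalSet σ i j = Finset.univ
    · rw [h1, hx, Finset.card_univ, Fintype.card_fin]
      apply le_of_eq
      push_cast
      ring
    exact h _ ((mem_polygonSets_iff σ).2 ⟨h0, h1, i, j, hij.1, rfl⟩)

theorem not_isPositive_one : ¬ IsPositive σ 1 := by
  rintro ⟨_, h⟩
  simp [extSign] at h

theorem not_isPositive_add_one : ¬ IsPositive σ (n + 1) := by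
  rintro ⟨_, h⟩
  simp [extSign] at h

end HohlwegLange

theorem mainTheorem9 (n : ℕ) (hn : 1 ≤ n) (σ σ' : Fin (n - 1) → ℤˣ) :
    NormallyIsomorphic (HohlwegLange.associahedron σ) (HohlwegLange.associahedron σ') ↔
      IsometricSets (HohlwegLange.associahedron σ) (HohlwegLange.associahedron σ') := by
  refine ⟨fun h => ?_, IsometricSets.normallyIsomorphic⟩
  rw [HohlwegLange.associahedron_eq_removahedron, HohlwegLange.associahedron_eq_removahedron] at h ⊢
  exact (isAssociahedral_polygonSets (HohlwegLange.not_isPositive_one σ)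
    (HohlwegLange.not_isPositive_add_one σ)).isometricSets
      (isAssociahedral_polygonSets (HohlwegLange.not_isPositive_one σ')
        (HohlwegLange.not_isPositive_add_one σ')) h
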